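/- Let $m\ge 2$ and let $M$ be an oriented and time-oriented globally hyperbolic Lorentzian manifold of dimension $m$ (globally hyperbolic: there is a Cauchy surface, i.e. a hypersurface of codimension $1$ that is met exactly once by every inextensible causal curve). Let $\Omega^p(M)$ be the real vector space of smooth $p$-forms, $\mathrm d$ the exterior derivative, $\ast$ the Hodge operator, determined by $\omega\wedge\ast\lambda=g(\omega,\lambda)\,\mathrm{vol}$, and let $\delta=(-1)^{p+1}\ast^{-1}\mathrm d\,\ast:\Omega^{p+1}(M)\to\Omega^{p}(M)$ be the codifferential, the formal adjoint of $\mathrm d$ for $\int_M\omega\wedge\ast\lambda$. Let $\mathbf{Ch}(\mathbb R)$ be the model category of unbounded chain complexes of real vector spaces, whose weak equivalences are the quasi-isomorphisms and whose fibrations are the degreewise surjective chain maps. For Abelian Yang–Mills theory with structure group $\mathbb R$ on $M$ consider the complexes $$\mathfrak F=\big(\overset{(0)}{\Omega^1(M)}\xleftarrow{\ \mathrm d\ }\overset{(1)}{\Omega^0(M)}\big),\qquad \mathfrak F^*=\big(\overset{(-1)}{\Omega^0(M)}\xleftarrow{\ -\delta\ }\overset{(0)}{\Omega^1(M)}\big),\qquad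 T^*\mathfrak F=\mathfrak F\times\mathfrak F^*,$$ the degrees being indicated in brackets. Let $\mathrm dS:\mathfrak F\to T^*\mathfrak F$ be the chain map with components $(\mathrm{id},\delta\mathrm d)$ in degree $0$ and $\mathrm{id}$ in degree $1$ (the variation of the Yang–Mills action), and let $0:\mathfrak F\to T^*\mathfrak F$ be the zero section, with components $(\mathrm{id},0)$ in degree $0$ and $\mathrm{id}$ in degree $1$. Then the chain complex $$\mathfrak{Sol}=\big(\overset{(-2)}{\Omega^0(M)}\xleftarrow{\ \delta\ }\overset{(-1)}{\Omega^1(M)}\xleftarrow{\ \delta\mathrm d\ }\overset{(0)}{\Omega^1(M)}\xleftarrow{\ \mathrm d\ }\overset{(1)}{\Omega^0(M)}\big),$$ with both projections to $\mathfrak F$ given by the chain map $\pi:\mathfrak{Sol}\to\mathfrak F$ that is the identity in the degrees $0$ and $1$, is a model for the homotopy pullback in $\mathbf{Ch}(\mathbb R)$ of $\mathrm dS:\mathfrak F\to T^*\mathfrak F$ and $0:\mathfrak F\to T^*\mathfrak F$. That is, the cospan $\mathfrak F\xrightarrow{\mathrm dS}T^*\mathfrak F\xleftarrow{0}\mathfrak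 F$ has a fibrant replacement (a cospan $X'\to Z'\leftarrow Y'$ of two fibrations, with weak equivalences $\alpha:\mathfrak F\to X'$, $\beta:\mathfrak F\to Y'$, $\gamma:T^*\mathfrak F\to Z'$ that commute with the maps of the cospans), and for each of them there is an isomorphism $\mathfrak{Sol}\cong X'\times_{Z'}Y'$ in the homotopy category of $\mathbf{Ch}(\mathbb R)$ under which the projections to $X'$ and $Y'$ correspond to $\alpha\pi$ and $\beta\pi$. -/

import Mathlib

open CategoryTheory CategoryTheory.Limits Topology
open scoped Manifold ContDiff
universe u
noncomputable section
namespace YangMills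
/-! ### Linear algebra: the Hodge operator of one tangent space -/

section Pointwise
set_option linter.unusedSectionVars false
variable {V W : Type*} [AddCommGroup V] [Module ℝ V] [TopologicalSpace V]
  [AddCommGroup W] [Module ℝ W] [TopologicalSpace W] {m p q : ℕ}

theorem append_update_right (u : Fin p → V) (v : Fin q → V) (i : Fin q) (z : V) :
    (Fin.append u (Function.update v i z)) =
      Function.update (Fin.append u v) (Fin.natAdd p i) z := by
  ext k
  refine Fin.addCases (fun k => ?_) (fun k => ?_) k
  · have : Fin.castAdd q k ≠ Fin.natAdd p i := by
      intro h
      have := congrArg Fin.val h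
      simp at this
      omega
    simp [Function.update_of_ne this]
  · by_cases hk : k = i
    · subst hk
      simp
    · have : Fin.natAdd p k ≠ Fin.natAdd p i := by simpa using hk
      simp [Function.update_of_ne this, Function.update_of_ne hk]

theorem append_update_left (u : Fin p → V) (v : Fin q → V) (i : Fin p) (z : V) :
    (Fin.append (Function.update u i z) v) =
      Function.update (Fin.append u v) (Fin.castAdd q i) z := by
  ext k
  refine Fin.addCases (fun k => ?_) (fun k => ?_) k
  · by_cases hk : k = i
    · subst hk
      simp
    · have : Fin.castAdd q k ≠ Fin.castAdd q i := by simpa using hk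
      simp [Function.update_of_ne this, Function.update_of_ne hk]
  · have : Fin.natAdd p k ≠ Fin.castAdd q i := by
      intro h
      have := congrArg Fin.val h
      simp at this
      omega
    simp [Function.update_of_ne this]

/-- The contraction `vol(u₁, …, u_p, ·, …, ·)` of an alternating `m`-form with `p` vectors in its
first slots, an alternating `q`-form, `p + q = m`. -/
def contractLeft (h : p + q = m) (vol : V [⋀^Fin m]→L[ℝ] ℝ) (u : Fin p → V) :
    V [⋀^Fin q]→L[ℝ] ℝ where
  toFun v := vol fun k => Fin.append u v (Fin.cast h.symm k)
  map_update_add' := by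
    subst h
    intro inst v i x y
    obtain rfl : inst = instDecidableEqFin q := Subsingleton.elim _ _
    simp only [Fin.cast_eq_self, append_update_right]
    exact vol.map_update_add _ _ _ _
  map_update_smul' := by
    subst h
    intro inst v i c x
    obtain rfl : inst = instDecidableEqFin q := Subsingleton.elim _ _
    simp only [Fin.cast_eq_self, append_update_right]
    exact vol.map_update_smul _ _ _ _
  cont := by
    refine vol.cont.comp (continuous_pi fun k => ?_)
    refine Fin.addCases (fun l => ?_) (fun l => ?_) (Fin.cast h.symm k)
    · simpa using continuous_const
    · simpa using continuous_apply l
  map_eq_zero_of_eq' := by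
    intro v i j hv hij
    subst h
    refine vol.map_eq_zero_of_eq _ (i := Fin.natAdd p i) (j := Fin.natAdd p j) ?_
      (by simpa using hij)
    simpa using hv

theorem contractLeft_apply (h : p + q = m) (vol : V [⋀^Fin m]→L[ℝ] ℝ) (u : Fin p → V)
    (v : Fin q → V) :
    contractLeft h vol u v = vol fun k => Fin.append u v (Fin.cast h.symm k) := rfl

/-- The frame `b¹, …, bᵐ` obtained from `b₁, …, b_m` by raising the index with the inverse of the
Gram matrix, so that `g(b_i, bʲ)` is the Kronecker delta. -/
def dualFrame (g : LinearMap.BilinForm ℝ V) (b : Fin m → V) (j : Fin m) : V :=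
  ∑ i, (Matrix.of fun i j => g (b i) (b j))⁻¹ i j • b i

/-- The Hodge operator in terms of a frame `b₁, …, b_m` :
`(⋆α)(v₁, …, v_q) = (1 / p!) ∑ α(b^{j₁}, …, b^{j_p}) vol(b_{j₁}, …, b_{j_p}, v₁, …, v_q)`.
If `b` is a basis, then it does not depend on `b` (see `hodgeAt_eq_of_basis`), and it is the
operator with `β ∧ ⋆α = g(β, α) vol`. -/
def hodgeAt (h : p + q = m) (g : LinearMap.BilinForm ℝ V) (vol : V [⋀^Fin m]→L[ℝ] ℝ)
    (b : Fin m → V) : (V [⋀^Fin p]→L[ℝ] ℝ) →ₗ[ℝ] (V [⋀^Fin q]→L[ℝ] ℝ) where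
  toFun α := (p.factorial : ℝ)⁻¹ •
    ∑ j : Fin p → Fin m, α (fun k => dualFrame g b (j k)) • contractLeft h vol (fun k => b (j k))
  map_add' α η := by
    simp [add_smul, Finset.sum_add_distrib]
  map_smul' c α := by
    simp only [ContinuousAlternatingMap.smul_apply, smul_eq_mul, mul_smul, ← Finset.smul_sum,
      RingHom.id_apply]
    rw [smul_comm]

theorem hodgeAt_apply (h : p + q = m) (g : LinearMap.BilinForm ℝ V) (vol : V [⋀^Fin m]→L[ℝ] ℝ)
    (b : Fin m → V) (α : V [⋀^Fin p]→L[ℝ] ℝ) (v : Fin q → V) :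
    hodgeAt h g vol b α v = (p.factorial : ℝ)⁻¹ *
      ∑ j : Fin p → Fin m, α (fun k => dualFrame g b (j k)) *
        vol (fun k => Fin.append (fun l => b (j l)) v (Fin.cast h.symm k)) := by
  simp [hodgeAt, contractLeft_apply]

theorem apply_dualFrame (g : LinearMap.BilinForm ℝ V) (hg : g.Nondegenerate)
    (b : Module.Basis (Fin m) ℝ V) (i j : Fin m) :
    g (b i) (dualFrame g b j) = if i = j then 1 else 0 := by
  have hdet : IsUnit (Matrix.of fun i j => g (b i) (b j)).det := by
    have := (LinearMap.BilinForm.nondegenerate_iff_det_ne_zero (B := g) b).1 hg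
    rw [isUnit_iff_ne_zero]
    convert this using 2
    ext i j
    simp
  have := congrFun (congrFun (Matrix.mul_nonsing_inv _ hdet) i) j
  rw [Matrix.mul_apply, Matrix.one_apply] at this
  simp only [dualFrame, map_sum, map_smul, smul_eq_mul]
  rw [← this]
  exact Finset.sum_congr rfl fun k _ => by simp [mul_comm]

theorem sum_apply_dualFrame_smul (g : LinearMap.BilinForm ℝ V) (hg : g.Nondegenerate)
    (b : Module.Basis (Fin m) ℝ V) (v : V) : ∑ j, g v (dualFrame g b j) • b j = v := by
  conv_rhs => rw [← b.sum_repr v]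
  refine Finset.sum_congr rfl fun j _ => ?_
  congr 1
  have : g v (dualFrame g b j) = g (∑ i, b.repr v i • b i) (dualFrame g b j) := by
    rw [b.sum_repr]
  rw [this, map_sum, LinearMap.sum_apply]
  simp [apply_dualFrame g hg b]

theorem sum_apply_smul_dualFrame (g : LinearMap.BilinForm ℝ V) (hg : g.Nondegenerate)
    (b : Module.Basis (Fin m) ℝ V) (w : V) : ∑ a, g (b a) w • dualFrame g b a = w := by
  have key : ∀ v, g v (∑ a, g (b a) w • dualFrame g b a) = g v w := by
    intro v
    conv_rhs => rw [← sum_apply_dualFrame_smul g hg b v]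
    simp [mul_comm]
  have := hg.2 (∑ a, g (b a) w • dualFrame g b a - w) (fun v => by rw [map_sub, key, sub_self])
  exact sub_eq_zero.1 this

theorem hodgeAt_eq_of_basis (h : p + q = m) (g : LinearMap.BilinForm ℝ V) (hg : g.Nondegenerate)
    (vol : V [⋀^Fin m]→L[ℝ] ℝ) (b b' : Module.Basis (Fin m) ℝ V) :
    (hodgeAt h g vol b : (V [⋀^Fin p]→L[ℝ] ℝ) →ₗ[ℝ] _) = hodgeAt h g vol b' := by
  ext α v
  rw [hodgeAt_apply, hodgeAt_apply]
  congr 1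
  have h1 : ∀ j : Fin p → Fin m, α (fun k => dualFrame g b (j k)) =
      ∑ a : Fin p → Fin m, (∏ k, g (b' (a k)) (dualFrame g b (j k))) *
        α (fun k => dualFrame g b' (a k)) := by
    intro j
    have : (fun k => dualFrame g b (j k)) = fun k => ∑ c, g (b' c) (dualFrame g b (j k)) •
        dualFrame g b' c := by
      ext k
      rw [sum_apply_smul_dualFrame g hg b']
    rw [this]
    have := (α.toMultilinearMap).map_sum
      (fun (k : Fin p) (c : Fin m) => g (b' c) (dualFrame g b (j k)) • dualFrame g b' c)
    refine this.trans (Finset.sum_congr rfl fun a _ => ?_)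
    exact (α.toMultilinearMap).map_smul_univ _ _
  have h2 : ∀ a : Fin p → Fin m,
      vol (fun k => Fin.append (fun l => b' (a l)) v (Fin.cast h.symm k)) =
      ∑ j : Fin p → Fin m, (∏ k, g (b' (a k)) (dualFrame g b (j k))) *
        vol (fun k => Fin.append (fun l => b (j l)) v (Fin.cast h.symm k)) := by
    intro a
    subst h
    let f : MultilinearMap ℝ (fun _ : Fin p => V) ℝ :=
      { toFun := fun u => vol (Fin.append u v)
        map_update_add' := by
          intro inst u i x y
          obtain rfl : inst = instDecidableEqFin p := Subsingleton.elim _ _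
          simp only [append_update_left]
          exact vol.map_update_add _ _ _ _
        map_update_smul' := by
          intro inst u i c x
          obtain rfl : inst = instDecidableEqFin p := Subsingleton.elim _ _
          simp only [append_update_left]
          exact vol.map_update_smul _ _ _ _ }
    have hb : (fun l => b' (a l)) = fun l => ∑ c, g (b' (a l)) (dualFrame g b c) • b c := by
      ext l
      rw [sum_apply_dualFrame_smul g hg b]
    change f (fun l => b' (a l)) = _
    rw [hb]
    refine (f.map_sum
      (fun (k : Fin p) (c : Fin (p + q)) => g (b' (a k)) (dualFrame g b c) • b c)).trans
      (Finset.sum_congr rfl fun j _ => ?_)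
    exact f.map_smul_univ _ _
  simp only [h1, h2, Finset.sum_mul, Finset.mul_sum]
  rw [Finset.sum_comm]
  refine Finset.sum_congr rfl fun a _ => Finset.sum_congr rfl fun j _ => ?_
  ring

theorem map_dualFrame (g : LinearMap.BilinForm ℝ V) (L : W →ₗ[ℝ] V) (b : Fin m → W) (j : Fin m) :
    L (dualFrame (g.comp L L) b j) = dualFrame g (fun i => L (b i)) j := by
  simp [dualFrame]

theorem hodgeAt_pullback (h : p + q = m) (g : LinearMap.BilinForm ℝ V)
    (vol : V [⋀^Fin m]→L[ℝ] ℝ) (L : W →L[ℝ] V) (b : Fin m → W) (α : V [⋀^Fin p]→L[ℝ] ℝ) :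
    (hodgeAt h g vol (fun i => L (b i)) α).compContinuousLinearMap L =
      hodgeAt h (g.comp (L : W →ₗ[ℝ] V) L) (vol.compContinuousLinearMap L) b
        (α.compContinuousLinearMap L) := by
  ext v
  simp only [ContinuousAlternatingMap.compContinuousLinearMap_apply, hodgeAt_apply]
  congr 1
  refine Finset.sum_congr rfl fun j _ => ?_
  congr 2
  · ext k
    exact (map_dualFrame g (L : W →ₗ[ℝ] V) b (j k)).symm
  · ext k
    subst h
    simp only [Fin.cast_eq_self, Function.comp]
    refine Fin.addCases (fun l => ?_) (fun l => ?_) k <;> simp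

/-- The Hodge operator of a nondegenerate form and a nonzero top form is injective. -/
theorem hodgeAt_injective (h : p + q = m) (g : LinearMap.BilinForm ℝ V) (hg : g.Nondegenerate)
    (vol : V [⋀^Fin m]→L[ℝ] ℝ) (b : Module.Basis (Fin m) ℝ V) (hvol : vol b ≠ 0) :
    Function.Injective (hodgeAt (p := p) h g vol b) := by
  rw [injective_iff_map_eq_zero]
  intro α hα
  subst h
  have hli : ∀ w : Fin p → V, α w = 0 ↔ α.toMultilinearMap w = 0 := fun w => Iff.rfl
  have hdual : ∀ i₀ : Fin p → Fin (p + q), Function.Injective i₀ →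
      α (fun k => dualFrame g b (i₀ k)) = 0 := by
    intro i₀ hi₀
    obtain ⟨j₀, hj₀⟩ : ∃ j₀ : Fin q → Fin (p + q), Function.Injective (Fin.append i₀ j₀) := by
      have hc : Fintype.card ((Set.range i₀)ᶜ : Set (Fin (p + q))) = q := by
        rw [Fintype.card_compl_set, Set.card_range_of_injective hi₀]
        simp
      let e := (Fintype.equivFinOfCardEq hc).symm
      refine ⟨fun k => (e k : Fin (p + q)), ?_⟩
      rw [Fin.append_injective_iff]
      refine ⟨hi₀, fun a c hac => e.injective (Subtype.ext hac), fun a c hac => ?_⟩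
      exact (e c).2 ⟨a, hac⟩
    have hbij : Function.Bijective (Fin.append i₀ j₀) := Finite.injective_iff_bijective.1 hj₀
    have hvol0 : vol (fun k => b (Fin.append i₀ j₀ k)) ≠ 0 := by
      have := vol.toAlternatingMap.map_perm b (Equiv.ofBijective _ hbij)
      intro h0
      have h1 : vol.toAlternatingMap (b ∘ (Equiv.ofBijective _ hbij)) = 0 := h0
      rw [this] at h1
      have h2 : vol.toAlternatingMap b = 0 := by
        rcases Int.units_eq_one_or (Equiv.Perm.sign (Equiv.ofBijective _ hbij)) with hs | hs <;>
          simpa [hs] using h1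
      exact hvol h2
    have hterm : ∀ j : Fin p → Fin (p + q),
        α (fun k => dualFrame g b (j k)) * vol (fun k => b (Fin.append j j₀ k)) =
        if Function.Injective (Fin.append j j₀) then
          α (fun k => dualFrame g b (i₀ k)) * vol (fun k => b (Fin.append i₀ j₀ k)) else 0 := by
      intro j
      split_ifs with hj
      · have hjb : Function.Bijective (Fin.append j j₀) := Finite.injective_iff_bijective.1 hj
        have hrange : ∀ k, ∃ l, j k = i₀ l := by
          intro k
          obtain ⟨c, hc⟩ := hbij.2 (j k)
          revert hc
          refine Fin.addCases (fun l hl => ?_) (fun l hl => ?_) c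
          · exact ⟨l, by simpa using hl.symm⟩
          · exfalso
            have h2 : Fin.append j j₀ (Fin.natAdd p l) = Fin.append j j₀ (Fin.castAdd q k) := by
              simpa using hl
            have := congrArg Fin.val (hj h2)
            simp at this
            omega
        choose s hs using hrange
        have hsinj : Function.Injective s := by
          intro a c hac
          have : j a = j c := by rw [hs, hs, hac]
          have h2 : Fin.append j j₀ (Fin.castAdd q a) = Fin.append j j₀ (Fin.castAdd q c) := by
            simpa using this
          simpa using hj h2
        let σ : Equiv.Perm (Fin p) := Equiv.ofBijective s (Finite.injective_iff_bijective.1 hsinj)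
        have e1 : α (fun k => dualFrame g b (j k)) =
            ((Equiv.Perm.sign σ : ℤˣ) : ℤ) • α (fun k => dualFrame g b (i₀ k)) := by
          have := α.toAlternatingMap.map_perm (fun k => dualFrame g b (i₀ k)) σ
          have e : (fun k => dualFrame g b (j k)) = (fun k => dualFrame g b (i₀ k)) ∘ σ := by
            ext k
            simp [hs, σ]
          rw [e]
          exact this
        let f : V [⋀^Fin p]→ₗ[ℝ] ℝ :=
          { toFun := fun u => vol (Fin.append u (fun k => b (j₀ k)))
            map_update_add' := by
              intro inst u i x y
              obtain rfl : inst = instDecidableEqFin p := Subsingleton.elim _ _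
              simp only [append_update_left]
              exact vol.map_update_add _ _ _ _
            map_update_smul' := by
              intro inst u i c x
              obtain rfl : inst = instDecidableEqFin p := Subsingleton.elim _ _
              simp only [append_update_left]
              exact vol.map_update_smul _ _ _ _
            map_eq_zero_of_eq' := by
              intro u i l hu hil
              refine vol.map_eq_zero_of_eq _ (i := Fin.castAdd q i) (j := Fin.castAdd q l) ?_
                (by simpa using hil)
              simpa using hu }
        have hf : ∀ j : Fin p → Fin (p + q), vol (fun k => b (Fin.append j j₀ k)) =
            f (fun k => b (j k)) := by
          intro j
          change _ = vol _
          congr 1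
          ext k
          refine Fin.addCases (fun l => ?_) (fun l => ?_) k <;> simp
        have e2 : vol (fun k => b (Fin.append j j₀ k)) =
            ((Equiv.Perm.sign σ : ℤˣ) : ℤ) • vol (fun k => b (Fin.append i₀ j₀ k)) := by
          rw [hf, hf]
          have := f.map_perm (fun k => b (i₀ k)) σ
          have e : (fun k => b (j k)) = (fun k => b (i₀ k)) ∘ σ := by
            ext k
            simp [hs, σ]
          rw [e]
          exact this
        rw [e1, e2]
        rcases Int.units_eq_one_or (Equiv.Perm.sign σ) with hs | hs <;> simp [hs]
      · have : vol (fun k => b (Fin.append j j₀ k)) = 0 := by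
          have hni : ¬ Function.Injective (fun k => b (Fin.append j j₀ k)) :=
            fun hi => hj (Function.Injective.of_comp hi)
          exact vol.toAlternatingMap.map_eq_zero_of_not_injective _ hni
        rw [this, mul_zero]
    have hsum := congrArg (fun η => η (fun k => b (j₀ k))) hα
    change hodgeAt rfl g vol b α (fun k => b (j₀ k)) = 0 at hsum
    rw [hodgeAt_apply, mul_eq_zero] at hsum
    have hsum := hsum.resolve_left (by positivity)
    have happ : ∀ j : Fin p → Fin (p + q),
        vol (fun k => Fin.append (fun l => b (j l)) (fun k => b (j₀ k)) (Fin.cast rfl k)) =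
        vol (fun k => b (Fin.append j j₀ k)) := by
      intro j
      congr 1
      ext k
      refine Fin.addCases (fun l => ?_) (fun l => ?_) k <;> simp
    classical
    have hsum2 := (Finset.sum_congr rfl fun (j : Fin p → Fin (p + q)) _ =>
      ((congrArg (α (fun k => dualFrame g b (j k)) * ·) (happ j)).trans (hterm j))).symm.trans hsum
    clear hsum
    rename' hsum2 => hsum
    rw [← Finset.sum_filter, Finset.sum_const, smul_eq_zero] at hsum
    rcases hsum with hc | hc
    · exfalso
      rw [Finset.card_eq_zero, Finset.filter_eq_empty_iff] at hc
      exact hc (Finset.mem_univ i₀) hj₀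
    · exact (mul_eq_zero.1 hc).resolve_right hvol0
  have hdb : LinearIndependent ℝ (dualFrame g b) := by
    rw [Fintype.linearIndependent_iff]
    intro c hc i
    have := congrArg (g (b i)) hc
    simpa [apply_dualFrame g hg b] using this
  have hspan : ⊤ ≤ Submodule.span ℝ (Set.range (dualFrame g b)) := by
    intro w _
    rw [← sum_apply_smul_dualFrame g hg b w]
    exact Submodule.sum_mem _ fun a _ =>
      Submodule.smul_mem _ _ (Submodule.subset_span ⟨a, rfl⟩)
  let d := Module.Basis.mk hdb hspan
  have : α.toAlternatingMap = 0 := by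
    refine Module.Basis.ext_alternating d fun i hi => ?_
    have := hdual i hi
    simpa [d] using this
  ext v
  exact congrArg (fun f : V [⋀^Fin p]→ₗ[ℝ] ℝ => f v) this

theorem finiteDimensional_forms (b : Module.Basis (Fin m) ℝ V) :
    FiniteDimensional ℝ (V [⋀^Fin p]→L[ℝ] ℝ) := by
  let e : (V [⋀^Fin p]→L[ℝ] ℝ) →ₗ[ℝ] ((Fin p → Fin m) → ℝ) :=
    { toFun := fun α j => α (fun k => b (j k))
      map_add' := fun _ _ => rfl
      map_smul' := fun _ _ => rfl }
  refine FiniteDimensional.of_injective e ?_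
  intro α β hαβ
  have : α.toAlternatingMap = β.toAlternatingMap :=
    Module.Basis.ext_alternating b fun i _ => congrFun hαβ i
  ext v
  exact congrArg (fun f : V [⋀^Fin p]→ₗ[ℝ] ℝ => f v) this

theorem hodgeAt_bijective (h : p + q = m) (g : LinearMap.BilinForm ℝ V) (hg : g.Nondegenerate)
    (vol : V [⋀^Fin m]→L[ℝ] ℝ) (b : Module.Basis (Fin m) ℝ V) (hvol : vol b ≠ 0) :
    Function.Bijective (hodgeAt (p := p) h g vol b) := by
  have h1 := hodgeAt_injective h g hg vol b hvol
  have h2 := hodgeAt_injective ((add_comm q p).trans h) g hg vol b hvol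
  have : FiniteDimensional ℝ (V [⋀^Fin p]→L[ℝ] ℝ) := finiteDimensional_forms b
  have : FiniteDimensional ℝ (V [⋀^Fin q]→L[ℝ] ℝ) := finiteDimensional_forms b
  have hd := le_antisymm (LinearMap.finrank_le_finrank_of_injective h1)
    (LinearMap.finrank_le_finrank_of_injective h2)
  exact ⟨h1, (LinearMap.injective_iff_surjective_of_finrank_eq_finrank hd).1 h1⟩

end Pointwise

/-! ### Differential forms on a manifold -/

/-- The model space `ℝᵐ`. -/
abbrev Model (m : ℕ) := EuclideanSpace ℝ (Fin m)

section Forms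
variable {m p q : ℕ} {M : Type u} [TopologicalSpace M] [ChartedSpace (Model m) M]

/-- The coordinate frame of the chart at `x₀`, as the linear map `∂(φ⁻¹) : ℝᵐ → T_{φ⁻¹(y)} M`. -/
def chartFrame (x₀ : M) (y : Model m) :
    Model m →L[ℝ] TangentSpace (𝓡 m) ((chartAt (Model m) x₀).symm y) :=
  mfderiv (𝓡 m) (𝓡 m) (chartAt (Model m) x₀).symm y

/-- The differential `T_x M → ℝᵐ` of the chart at `x₀`. -/
def chartDiff (x₀ x : M) : TangentSpace (𝓡 m) x →L[ℝ] Model m :=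
  mfderiv (𝓡 m) (𝓡 m) (chartAt (Model m) x₀) x

/-- The coordinate expression, on `ℝᵐ`, of a field of alternating `p`-forms in the chart at `x₀`:
its pullback along the inverse of the chart. -/
def chartForm (α : ∀ x : M, TangentSpace (𝓡 m) x [⋀^Fin p]→L[ℝ] ℝ) (x₀ : M) (y : Model m) :
    Model m [⋀^Fin p]→L[ℝ] ℝ :=
  (α ((chartAt (Model m) x₀).symm y)).compContinuousLinearMap (chartFrame x₀ y)

variable (m p M) in
/-- The real vector space `Ωᵖ(M)` of smooth differential `p`-forms on `M` : fields of alternating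
`p`-forms on the tangent spaces whose coordinate expressions are smooth. -/
def DiffForm : Submodule ℝ (∀ x : M, TangentSpace (𝓡 m) x [⋀^Fin p]→L[ℝ] ℝ) where
  carrier := {α | ∀ x₀ : M, ContDiffOn ℝ ∞ (chartForm α x₀) (chartAt (Model m) x₀).target}
  add_mem' ha hb x₀ := (ha x₀).add (hb x₀)
  zero_mem' _ := contDiffOn_const (c := (0 : Model m [⋀^Fin p]→L[ℝ] ℝ))
  smul_mem' c _ ha x₀ := (ha x₀).const_smul c

theorem chartDiff_comp_chartFrame [IsManifold (𝓡 m) ∞ M] (x₀ : M) {y : Model m}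
    (hy : y ∈ (chartAt (Model m) x₀).target) :
    (chartDiff x₀ _).comp (chartFrame x₀ y) = ContinuousLinearMap.id ℝ (Model m) :=
  (mdifferentiable_chart (I := 𝓡 m) x₀).comp_symm_deriv hy

theorem chartFrame_comp_chartDiff [IsManifold (𝓡 m) ∞ M] (x₀ : M) {y : Model m}
    (hy : y ∈ (chartAt (Model m) x₀).target) :
    (chartFrame x₀ y).comp (chartDiff x₀ _) = ContinuousLinearMap.id ℝ _ := by
  have h := (mdifferentiable_chart (I := 𝓡 m) x₀).symm_comp_deriv
    ((chartAt (Model m) x₀).map_target hy)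
  have e := (chartAt (Model m) x₀).right_inv hy
  rw [e] at h
  exact h

/-- The coordinate frame as an isomorphism `ℝᵐ ≃ T_{φ⁻¹(y)} M`. -/
def chartEquiv [IsManifold (𝓡 m) ∞ M] (x₀ : M) {y : Model m}
    (hy : y ∈ (chartAt (Model m) x₀).target) :
    Model m ≃L[ℝ] TangentSpace (𝓡 m) ((chartAt (Model m) x₀).symm y) :=
  ContinuousLinearEquiv.equivOfInverse (chartFrame x₀ y) (chartDiff x₀ _)
    (fun v => congrArg (fun f : Model m →L[ℝ] Model m => f v) (chartDiff_comp_chartFrame x₀ hy))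
    (fun v => congrArg (fun f : TangentSpace (𝓡 m) ((chartAt (Model m) x₀).symm y) →L[ℝ]
      TangentSpace (𝓡 m) ((chartAt (Model m) x₀).symm y) => f v) (chartFrame_comp_chartDiff x₀ hy))

theorem chartForm_chart_self [IsManifold (𝓡 m) ∞ M]
    (α : ∀ x : M, TangentSpace (𝓡 m) x [⋀^Fin p]→L[ℝ] ℝ) (x₀ : M) {y : Model m}
    (hy : y ∈ (chartAt (Model m) x₀).target) :
    (chartForm α x₀ y).compContinuousLinearMap (chartDiff x₀ _) =
      α ((chartAt (Model m) x₀).symm y) := by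
  ext v
  have h := chartFrame_comp_chartDiff x₀ hy
  simp only [chartForm, ContinuousAlternatingMap.compContinuousLinearMap_apply]
  congr 1
  ext k
  exact congrArg (fun f : TangentSpace (𝓡 m) ((chartAt (Model m) x₀).symm y) →L[ℝ]
      TangentSpace (𝓡 m) ((chartAt (Model m) x₀).symm y) => f (v k)) h

theorem chartForm_chart_self_of_mem [IsManifold (𝓡 m) ∞ M]
    (α : ∀ x : M, TangentSpace (𝓡 m) x [⋀^Fin p]→L[ℝ] ℝ) (x₀ : M) {x : M}
    (hx : x ∈ (chartAt (Model m) x₀).source) :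
    (chartForm α x₀ (chartAt (Model m) x₀ x)).compContinuousLinearMap (chartDiff x₀ x) = α x := by
  have h1 := chartForm_chart_self α x₀ ((chartAt (Model m) x₀).map_source hx)
  have e := (chartAt (Model m) x₀).left_inv hx
  rw [e] at h1
  exact h1

/-- A form is determined by its coordinate expressions. -/
theorem ext_chartForm [IsManifold (𝓡 m) ∞ M]
    {α β : ∀ x : M, TangentSpace (𝓡 m) x [⋀^Fin p]→L[ℝ] ℝ}
    (h : ∀ x₀, ∀ y ∈ (chartAt (Model m) x₀).target, chartForm α x₀ y = chartForm β x₀ y) :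
    α = β := by
  funext x
  have hx := mem_chart_source (Model m) x
  rw [← chartForm_chart_self_of_mem α x hx, ← chartForm_chart_self_of_mem β x hx,
    h x _ ((chartAt (Model m) x).map_source hx)]

/-- The exterior derivative of a field of forms, computed at `x` in the chart at `x`. -/
def extDAt (α : ∀ x : M, TangentSpace (𝓡 m) x [⋀^Fin p]→L[ℝ] ℝ) (x : M) :
    TangentSpace (𝓡 m) x [⋀^Fin (p + 1)]→L[ℝ] ℝ :=
  (extDeriv (chartForm α x) (chartAt (Model m) x x)).compContinuousLinearMap (chartDiff x x)

/-- In every chart, the exterior derivative is the exterior derivative of the coordinate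
expression. -/
theorem chartForm_extDAt [IsManifold (𝓡 m) ∞ M] (α : DiffForm m p M) (x₀ : M) {y : Model m}
    (hy : y ∈ (chartAt (Model m) x₀).target) :
    chartForm (extDAt α.1) x₀ y = extDeriv (chartForm α.1 x₀) y := by
  set φ := chartAt (Model m) x₀ with hφ
  set z := φ.symm y with hz
  set ψ := chartAt (Model m) z with hψ
  have hzs : z ∈ ψ.source := mem_chart_source _ z
  have hτ : ContDiffOn ℝ ∞ (ψ ∘ φ.symm) (φ.symm.trans ψ).source := by
    have := (contDiffGroupoid ∞ (𝓡 m)).compatible (chart_mem_atlas (Model m) x₀)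
      (chart_mem_atlas (Model m) z)
    have := ((contDiffGroupoid ∞ (𝓡 m)).mem_iff_of_eqOnSource (Setoid.refl _)).1 this
    rw [contDiffGroupoid, mem_groupoid_of_pregroupoid] at this
    simpa [contDiffPregroupoid] using this.1
  have hopen : IsOpen (φ.symm.trans ψ).source := (φ.symm.trans ψ).open_source
  have hmem : y ∈ (φ.symm.trans ψ).source := by
    rw [OpenPartialHomeomorph.trans_source]
    exact ⟨hy, hzs⟩
  have hD : ∀ y' ∈ (φ.symm.trans ψ).source, fderiv ℝ (ψ ∘ φ.symm) y' =
      (chartDiff z (φ.symm y')).comp (chartFrame x₀ y') := by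
    intro y' hy'
    rw [OpenPartialHomeomorph.trans_source] at hy'
    have h1 := (mdifferentiable_chart (I := 𝓡 m) x₀).mdifferentiableAt_symm hy'.1
    have h2 := (mdifferentiable_chart (I := 𝓡 m) z).mdifferentiableAt hy'.2
    rw [← mfderiv_eq_fderiv]
    exact mfderiv_comp y' h2 h1
  have hev : chartForm α.1 x₀ =ᶠ[𝓝 y] fun y' =>
      (chartForm α.1 z ((ψ ∘ φ.symm) y')).compContinuousLinearMap
        (fderiv ℝ (ψ ∘ φ.symm) y') := by
    filter_upwards [hopen.mem_nhds hmem] with y' hy'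
    rw [hD y' hy']
    rw [OpenPartialHomeomorph.trans_source] at hy'
    have := chartForm_chart_self_of_mem α.1 z hy'.2
    ext v
    have := congrArg (fun β => β (fun k => chartFrame x₀ y' (v k))) this
    exact this.symm
  rw [hev.extDeriv_eq, extDeriv_pullback (r := ∞), hD y hmem]
  · rfl
  · exact ((α.2 z).contDiffAt (ψ.open_target.mem_nhds (ψ.map_source hzs))).differentiableAt
      (by simp)
  · exact hτ.contDiffAt (hopen.mem_nhds hmem)
  · rw [minSmoothness_of_isRCLikeNormedField]
    exact ENat.LEInfty.out

theorem contDiffOn_extDeriv {s : Set (Model m)} (hs : IsOpen s)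
    {f : Model m → Model m [⋀^Fin p]→L[ℝ] ℝ} (hf : ContDiffOn ℝ ∞ f s) :
    ContDiffOn ℝ ∞ (extDeriv f) s :=
  (ContinuousAlternatingMap.alternatizeUncurryFinCLM ℝ (Model m) ℝ).contDiff.comp_contDiffOn
    (hf.fderiv_of_isOpen hs (by simp))

/-- The exterior derivative `d : Ωᵖ(M) → Ωᵖ⁺¹(M)`. -/
def extD [IsManifold (𝓡 m) ∞ M] (p : ℕ) : DiffForm m p M →ₗ[ℝ] DiffForm m (p + 1) M where
  toFun α := ⟨extDAt α.1, fun x₀ =>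
    (contDiffOn_extDeriv (chartAt (Model m) x₀).open_target (α.2 x₀)).congr
      fun _ hy => chartForm_extDAt α x₀ hy⟩
  map_add' α β := by
    refine Subtype.ext (ext_chartForm fun x₀ y hy => ?_)
    have hn := (chartAt (Model m) x₀).open_target.mem_nhds hy
    have ha := ((α.2 x₀).contDiffAt hn).differentiableAt (by simp)
    have hb := ((β.2 x₀).contDiffAt hn).differentiableAt (by simp)
    have h1 := chartForm_extDAt (α + β) x₀ hy
    have h2 : chartForm (extDAt α.1 + extDAt β.1) x₀ y =
      chartForm (extDAt α.1) x₀ y + chartForm (extDAt β.1) x₀ y := rfl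
    refine h1.trans (Eq.trans ?_ h2.symm)
    rw [chartForm_extDAt α x₀ hy, chartForm_extDAt β x₀ hy]
    exact extDeriv_add ha hb
  map_smul' c α := by
    refine Subtype.ext (ext_chartForm fun x₀ y hy => ?_)
    have h1 := chartForm_extDAt (c • α) x₀ hy
    have h2 : chartForm (c • extDAt α.1) x₀ y = c • chartForm (extDAt α.1) x₀ y := rfl
    refine h1.trans (Eq.trans ?_ h2.symm)
    rw [chartForm_extDAt α x₀ hy]
    exact extDeriv_smul c (chartForm α.1 x₀)

theorem extD_extD [IsManifold (𝓡 m) ∞ M] (p : ℕ) (α : DiffForm m p M) :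
    extD (p + 1) (extD p α) = 0 := by
  refine Subtype.ext (ext_chartForm fun x₀ y hy => ?_)
  have hn := (chartAt (Model m) x₀).open_target.mem_nhds hy
  have h1 := chartForm_extDAt (extD p α) x₀ hy
  have h2 : chartForm (extD p α).1 x₀ =ᶠ[𝓝 y] extDeriv (chartForm α.1 x₀) := by
    filter_upwards [hn] with y' hy'
    exact chartForm_extDAt α x₀ hy'
  refine h1.trans ?_
  rw [h2.extDeriv_eq]
  exact extDeriv_extDeriv_apply ((α.2 x₀).contDiffAt hn) (by rw [minSmoothness_of_isRCLikeNormedField]; exact ENat.LEInfty.out)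

end Forms

/-! ### Lorentzian metrics, volume forms, the Hodge operator and the codifferential -/

section Lorentz
variable {m p q : ℕ} {M : Type u} [TopologicalSpace M] [ChartedSpace (Model m) M]

variable (m M) in
/-- A smooth Lorentzian metric on `M`, of signature `(-, +, …, +)`. -/
structure LorentzianMetric where
  /-- The scalar product on each tangent space. -/
  val : ∀ x : M, LinearMap.BilinForm ℝ (TangentSpace (𝓡 m) x)
  symm : ∀ x v w, val x v w = val x w v
  /-- There is a negative vector whose orthogonal complement is positive definite. -/
  lorentzian : ∀ x, ∃ t, val x t t < 0 ∧ ∀ v, val x t v = 0 → v ≠ 0 → 0 < val x v v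
  /-- The components in every chart are smooth. -/
  smooth : ∀ (x₀ : M) (u v : Model m), ContDiffOn ℝ ∞
    (fun y => val ((chartAt (Model m) x₀).symm y) (chartFrame x₀ y u) (chartFrame x₀ y v))
    (chartAt (Model m) x₀).target

/-- An orientation of the Lorentzian manifold `(M, g)`, given by its volume form : a smooth
`m`-form `vol` with `vol(v₁, …, v_m)² = |det g(v_i, v_j)|`, that is, with values `± 1` on the
orthonormal frames. (An orientation determines such a form, which is `1` on the positively
oriented orthonormal frames, and such a form determines an orientation.) -/
structure VolumeForm (g : LorentzianMetric m M) where
  form : DiffForm m m M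
  sq_apply : ∀ (x : M) (v : Fin m → TangentSpace (𝓡 m) x),
    form.1 x v ^ 2 = |(Matrix.of fun i j => g.val x (v i) (v j)).det|

/-- The standard basis of `T_x M = ℝᵐ`. -/
def tangentBasis (x : M) : Module.Basis (Fin m) ℝ (TangentSpace (𝓡 m) x) :=
  (EuclideanSpace.basisFun (Fin m) ℝ).toBasis

theorem LorentzianMetric.nondegenerate (g : LorentzianMetric m M) (x : M) :
    (g.val x).Nondegenerate := by
  have key : ∀ v, (∀ w, g.val x v w = 0) → v = 0 := by
    intro v hv
    obtain ⟨t, -, ht⟩ := g.lorentzian x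
    by_contra hne
    have := ht v (by rw [g.symm]; exact hv t) hne
    rw [hv v] at this
    exact lt_irrefl _ this
  exact ⟨key, fun v hv => key v fun w => by rw [g.symm]; exact hv w⟩

theorem VolumeForm.apply_ne_zero {g : LorentzianMetric m M} (o : VolumeForm g) (x : M)
    (b : Module.Basis (Fin m) ℝ (TangentSpace (𝓡 m) x)) : o.form.1 x b ≠ 0 := by
  intro h0
  have h := o.sq_apply x b
  rw [h0] at h
  have hd := (LinearMap.BilinForm.nondegenerate_iff_det_ne_zero (B := g.val x) b).1
    (g.nondegenerate x)
  apply hd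
  have : (Matrix.of fun i j => g.val x (b i) (b j)).det = 0 := by
    rw [← abs_eq_zero, ← h]
    simp
  rw [← this]
  congr 1
  ext i j
  simp

/-- The coordinate expression of the metric. -/
def chartMetric (g : LorentzianMetric m M) (x₀ : M) (y : Model m) :
    LinearMap.BilinForm ℝ (Model m) :=
  (g.val ((chartAt (Model m) x₀).symm y)).comp (chartFrame x₀ y : Model m →ₗ[ℝ] _)
    (chartFrame x₀ y)

/-- The Hodge operator on fields of forms. -/
def hodgeField (h : p + q = m) (g : LorentzianMetric m M) (o : VolumeForm g)
    (α : ∀ x : M, TangentSpace (𝓡 m) x [⋀^Fin p]→L[ℝ] ℝ) (x : M) :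
    TangentSpace (𝓡 m) x [⋀^Fin q]→L[ℝ] ℝ :=
  hodgeAt h (g.val x) (o.form.1 x) (tangentBasis x) (α x)

abbrev stdBasis (m : ℕ) : Module.Basis (Fin m) ℝ (Model m) :=
  (EuclideanSpace.basisFun (Fin m) ℝ).toBasis

theorem chartForm_hodgeField [IsManifold (𝓡 m) ∞ M] (h : p + q = m) (g : LorentzianMetric m M)
    (o : VolumeForm g) (α : ∀ x : M, TangentSpace (𝓡 m) x [⋀^Fin p]→L[ℝ] ℝ) (x₀ : M)
    {y : Model m} (hy : y ∈ (chartAt (Model m) x₀).target) :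
    chartForm (hodgeField h g o α) x₀ y =
      hodgeAt h (chartMetric g x₀ y) (chartForm o.form.1 x₀ y) (stdBasis m)
        (chartForm α x₀ y) := by
  let b := (stdBasis m).map (chartEquiv x₀ hy).toLinearEquiv
  have h1 : hodgeField h g o α ((chartAt (Model m) x₀).symm y) =
      hodgeAt h (g.val _) (o.form.1 _) b (α _) :=
    congrArg (fun f => f (α ((chartAt (Model m) x₀).symm y)))
      (hodgeAt_eq_of_basis h _ (g.nondegenerate _) (o.form.1 _) (tangentBasis _) b)
  have h2 : (b : Fin m → TangentSpace (𝓡 m) ((chartAt (Model m) x₀).symm y)) =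
      fun i => chartFrame x₀ y (stdBasis m i) := by
    ext i
    simp only [b, Module.Basis.map_apply]
    rfl
  rw [h2] at h1
  have h3 := hodgeAt_pullback h (g.val _) (o.form.1 _) (chartFrame x₀ y) (stdBasis m)
    (α ((chartAt (Model m) x₀).symm y))
  rw [← h1] at h3
  exact h3

theorem chartMetric_nondegenerate [IsManifold (𝓡 m) ∞ M] (g : LorentzianMetric m M) (x₀ : M)
    {y : Model m} (hy : y ∈ (chartAt (Model m) x₀).target) :
    (chartMetric g x₀ y).Nondegenerate := by
  have key : ∀ v, (∀ w, chartMetric g x₀ y v w = 0) → v = 0 := by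
    intro v hv
    have : chartEquiv x₀ hy v = 0 := by
      refine (g.nondegenerate _).1 _ fun w => ?_
      have := hv ((chartEquiv x₀ hy).symm w)
      have e : chartFrame x₀ y ((chartEquiv x₀ hy).symm w) = w :=
        (chartEquiv x₀ hy).apply_symm_apply w
      simp only [chartMetric, LinearMap.BilinForm.comp_apply, ContinuousLinearMap.coe_coe, e]
        at this
      exact this
    simpa using this
  refine ⟨key, fun v hv => key v fun w => ?_⟩
  have := hv w
  simp only [chartMetric, LinearMap.BilinForm.comp_apply] at this ⊢
  rw [g.symm]
  exact this

theorem chartForm_vol_ne_zero [IsManifold (𝓡 m) ∞ M] {g : LorentzianMetric m M}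
    (o : VolumeForm g) (x₀ : M) {y : Model m} (hy : y ∈ (chartAt (Model m) x₀).target) :
    chartForm o.form.1 x₀ y (stdBasis m) ≠ 0 := by
  have h1 := o.apply_ne_zero _ ((stdBasis m).map (chartEquiv x₀ hy).toLinearEquiv)
  intro h0
  apply h1
  rw [← h0]
  simp only [chartForm, ContinuousAlternatingMap.compContinuousLinearMap_apply]
  congr 1

theorem contDiffOn_form_of_apply {s : Set (Model m)} {f : Model m → Model m [⋀^Fin p]→L[ℝ] ℝ}
    (hf : ∀ v : Fin p → Model m, ContDiffOn ℝ ∞ (fun y => f y v) s) : ContDiffOn ℝ ∞ f s := by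
  have := finiteDimensional_forms (p := p) (stdBasis m)
  let e : (Model m [⋀^Fin p]→L[ℝ] ℝ) →ₗ[ℝ] ((Fin p → Fin m) → ℝ) :=
    { toFun := fun α j => α (fun k => stdBasis m (j k))
      map_add' := fun _ _ => rfl
      map_smul' := fun _ _ => rfl }
  have he : LinearMap.ker e = ⊥ := by
    refine LinearMap.ker_eq_bot.2 ?_
    intro α β hαβ
    have : α.toAlternatingMap = β.toAlternatingMap :=
      Module.Basis.ext_alternating (stdBasis m) fun i _ => congrFun hαβ i
    ext v
    exact congrArg (fun f : Model m [⋀^Fin p]→ₗ[ℝ] ℝ => f v) this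
  obtain ⟨r, hr⟩ := e.exists_leftInverse_of_injective he
  have hfr : f = fun y => r.toContinuousLinearMap (e (f y)) := by
    ext1 y
    exact (congrArg (fun l : (Model m [⋀^Fin p]→L[ℝ] ℝ) →ₗ[ℝ] _ => l (f y)) hr).symm
  rw [hfr]
  refine (r.toContinuousLinearMap.contDiff).comp_contDiffOn ?_
  exact contDiffOn_pi.2 fun j => hf _

theorem contDiffOn_form_apply {s : Set (Model m)} {f : Model m → Model m [⋀^Fin p]→L[ℝ] ℝ}
    (hf : ContDiffOn ℝ ∞ f s) (v : Fin p → Model m) : ContDiffOn ℝ ∞ (fun y => f y v) s := by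
  let e : (Model m [⋀^Fin p]→L[ℝ] ℝ) →ₗ[ℝ] ℝ :=
    { toFun := fun α => α v
      map_add' := fun _ _ => rfl
      map_smul' := fun _ _ => rfl }
  have := finiteDimensional_forms (p := p) (stdBasis m)
  exact (e.toContinuousLinearMap.contDiff).comp_contDiffOn hf

theorem contDiffOn_det {s : Set (Model m)} {A : Model m → Matrix (Fin m) (Fin m) ℝ}
    (hA : ∀ i j, ContDiffOn ℝ ∞ (fun y => A y i j) s) : ContDiffOn ℝ ∞ (fun y => (A y).det) s := by
  simp only [Matrix.det_apply]
  exact ContDiffOn.sum fun σ _ => (contDiffOn_prod fun i _ => hA _ _).const_smul _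

theorem contDiffOn_inv {s : Set (Model m)} {A : Model m → Matrix (Fin m) (Fin m) ℝ}
    (hA : ∀ i j, ContDiffOn ℝ ∞ (fun y => A y i j) s) (hdet : ∀ y ∈ s, (A y).det ≠ 0)
    (i j : Fin m) : ContDiffOn ℝ ∞ (fun y => (A y)⁻¹ i j) s := by
  simp only [Matrix.inv_def, Matrix.smul_apply, smul_eq_mul, Ring.inverse_eq_inv',
    Matrix.adjugate_apply]
  refine ((contDiffOn_det hA).inv hdet).mul (contDiffOn_det fun k l => ?_)
  by_cases hk : k = j
  · subst hk
    simpa using contDiffOn_const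
  · simpa [Matrix.updateRow_ne hk] using hA k l

theorem contDiffOn_hodgeAt (h : p + q = m) {s : Set (Model m)}
    {G : Model m → LinearMap.BilinForm ℝ (Model m)}
    (hG : ∀ u v, ContDiffOn ℝ ∞ (fun y => G y u v) s) (hn : ∀ y ∈ s, (G y).Nondegenerate)
    {vol : Model m → Model m [⋀^Fin m]→L[ℝ] ℝ} (hvol : ContDiffOn ℝ ∞ vol s)
    {α : Model m → Model m [⋀^Fin p]→L[ℝ] ℝ} (hα : ContDiffOn ℝ ∞ α s) :
    ContDiffOn ℝ ∞ (fun y => hodgeAt h (G y) (vol y) (stdBasis m) (α y)) s := by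
  refine contDiffOn_form_of_apply fun v => ?_
  simp only [hodgeAt_apply]
  refine contDiffOn_const.mul (ContDiffOn.sum fun j _ => ?_)
  refine ContDiffOn.mul ?_ (contDiffOn_form_apply hvol _)
  have hx : ∀ y, α y (fun k => dualFrame (G y) (stdBasis m) (j k)) =
      ∑ c : Fin p → Fin m, (∏ k, (Matrix.of fun i j => G y (stdBasis m i) (stdBasis m j))⁻¹
        (c k) (j k)) * α y (fun k => stdBasis m (c k)) := by
    intro y
    refine ((α y).toMultilinearMap.map_sum (fun (k : Fin p) (c : Fin m) =>
      (Matrix.of fun i j => G y (stdBasis m i) (stdBasis m j))⁻¹ c (j k) • stdBasis m c)).trans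
      (Finset.sum_congr rfl fun c _ => ?_)
    exact (α y).toMultilinearMap.map_smul_univ _ _
  simp only [hx]
  refine ContDiffOn.sum fun c _ => ?_
  refine ContDiffOn.mul (contDiffOn_prod fun k _ => ?_) (contDiffOn_form_apply hα _)
  refine contDiffOn_inv (fun i j => hG _ _) (fun y hy => ?_) _ _
  have := (LinearMap.BilinForm.nondegenerate_iff_det_ne_zero (B := G y) (stdBasis m)).1 (hn y hy)
  have e : (LinearMap.BilinForm.toMatrix (stdBasis m)) (G y) =
      Matrix.of fun i j => G y (stdBasis m i) (stdBasis m j) := by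
    ext i j
    simp
  rw [e] at this
  exact this

/-- The Hodge operator `⋆ : Ωᵖ(M) → Ω^q(M)`, `p + q = m`. -/
def hodge [IsManifold (𝓡 m) ∞ M] (h : p + q = m) (g : LorentzianMetric m M) (o : VolumeForm g) :
    DiffForm m p M →ₗ[ℝ] DiffForm m q M where
  toFun α := ⟨hodgeField h g o α.1, fun x₀ =>
    (contDiffOn_hodgeAt h (fun u v => g.smooth x₀ u v)
      (fun _ hy => chartMetric_nondegenerate g x₀ hy) (o.form.2 x₀) (α.2 x₀)).congr
      fun _ hy => chartForm_hodgeField h g o α.1 x₀ hy⟩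
  map_add' α β := Subtype.ext (funext fun x =>
    (hodgeAt h (g.val x) (o.form.1 x) (tangentBasis x)).map_add (α.1 x) (β.1 x))
  map_smul' c α := Subtype.ext (funext fun x =>
    (hodgeAt h (g.val x) (o.form.1 x) (tangentBasis x)).map_smul c (α.1 x))

theorem hodge_bijective [IsManifold (𝓡 m) ∞ M] (h : p + q = m) (g : LorentzianMetric m M)
    (o : VolumeForm g) : Function.Bijective (hodge h g o : DiffForm m p M →ₗ[ℝ] _) := by
  have hb : ∀ x : M, Function.Bijective
      (hodgeAt (p := p) h (g.val x) (o.form.1 x) (tangentBasis x)) := fun x =>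
    hodgeAt_bijective h _ (g.nondegenerate x) _ _ (o.apply_ne_zero x _)
  constructor
  · intro α β hαβ
    refine Subtype.ext (funext fun x => (hb x).1 ?_)
    exact congrFun (congrArg Subtype.val hαβ) x
  · intro η
    choose α hα using fun x => (hb x).2 (η.1 x)
    refine ⟨⟨α, fun x₀ => ?_⟩, Subtype.ext (funext hα)⟩
    have hfield : hodgeField h g o α = η.1 := funext hα
    have := finiteDimensional_forms (p := p) (stdBasis m)
    have := finiteDimensional_forms (p := q) (stdBasis m)
    let L : Model m → (Model m [⋀^Fin p]→L[ℝ] ℝ) →L[ℝ] (Model m [⋀^Fin q]→L[ℝ] ℝ) := fun y =>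
      (hodgeAt h (chartMetric g x₀ y) (chartForm o.form.1 x₀ y)
        (stdBasis m)).toContinuousLinearMap
    have hL : ContDiffOn ℝ ∞ L (chartAt (Model m) x₀).target := by
      refine contDiffOn_clm_apply.2 fun β => ?_
      exact contDiffOn_hodgeAt h (fun u v => g.smooth x₀ u v)
        (fun _ hy => chartMetric_nondegenerate g x₀ hy) (o.form.2 x₀) contDiffOn_const
    have hLb : ∀ y ∈ (chartAt (Model m) x₀).target, ∃ e : (Model m [⋀^Fin p]→L[ℝ] ℝ) ≃L[ℝ]
        (Model m [⋀^Fin q]→L[ℝ] ℝ), (e : _ →L[ℝ] _) = L y := by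
      intro y hy
      refine ⟨(LinearEquiv.ofBijective _ (hodgeAt_bijective h (chartMetric g x₀ y)
        (chartMetric_nondegenerate g x₀ hy) (chartForm o.form.1 x₀ y) (stdBasis m)
        (chartForm_vol_ne_zero o x₀ hy))).toContinuousLinearEquiv, ?_⟩
      ext1 β
      rfl
    have hinv : ContDiffOn ℝ ∞ (fun y => (L y).inverse (chartForm η.1 x₀ y))
        (chartAt (Model m) x₀).target := by
      refine ContDiffOn.clm_apply ?_ (η.2 x₀)
      intro y hy
      obtain ⟨e, he⟩ := hLb y hy
      have h1 : ContDiffAt ℝ ∞ ContinuousLinearMap.inverse (L y) := by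
        rw [← he]
        exact contDiffAt_map_inverse e
      exact h1.comp_contDiffWithinAt y (hL y hy)
    refine hinv.congr fun y hy => ?_
    obtain ⟨e, he⟩ := hLb y hy
    have h1 : chartForm η.1 x₀ y = L y (chartForm α x₀ y) := by
      rw [← hfield]
      exact chartForm_hodgeField h g o α x₀ hy
    rw [h1, ← he]
    simp

/-- The Hodge operator as a linear isomorphism. -/
def hodgeEquiv [IsManifold (𝓡 m) ∞ M] (h : p + q = m) (g : LorentzianMetric m M)
    (o : VolumeForm g) : DiffForm m p M ≃ₗ[ℝ] DiffForm m q M :=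
  LinearEquiv.ofBijective (hodge h g o) (hodge_bijective h g o)

/-- The codifferential `δ = (-1)^{p+1} ⋆⁻¹ d ⋆ : Ωᵖ⁺¹(M) → Ωᵖ(M)`. The sign is the one for which
`dω ∧ ⋆λ - ω ∧ ⋆δλ = d(ω ∧ ⋆λ)`, so that `δ` is formally adjoint to `d` for `∫ ω ∧ ⋆λ`. -/
def codiff [IsManifold (𝓡 m) ∞ M] (h : p + 1 + q = m) (g : LorentzianMetric m M)
    (o : VolumeForm g) : DiffForm m (p + 1) M →ₗ[ℝ] DiffForm m p M :=
  (-1 : ℝ) ^ (p + 1) • ((hodgeEquiv (p := p) (q := q + 1) (by omega) g o).symm.toLinearMap ∘ₗ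
    extD q ∘ₗ (hodgeEquiv h g o).toLinearMap)

theorem codiff_codiff [IsManifold (𝓡 m) ∞ M] {r : ℕ} (h : p + 1 + 1 + q = m)
    (h2 : p + 1 + r = m) (g : LorentzianMetric m M) (o : VolumeForm g)
    (α : DiffForm m (p + 1 + 1) M) : codiff h2 g o (codiff h g o α) = 0 := by
  obtain rfl : r = q + 1 := by omega
  simp [codiff, extD_extD]

end Lorentz

/-! ### Space-times -/

section Spacetimes
variable {m : ℕ} {M : Type u} [TopologicalSpace M] [ChartedSpace (Model m) M]

/-- A time-orientation of `(M, g)`, given by a smooth timelike vector field. -/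
structure TimeOrientation [IsManifold (𝓡 m) ∞ M] (g : LorentzianMetric m M) where
  field : ∀ x : M, TangentSpace (𝓡 m) x
  smooth : ContMDiff (𝓡 m) (𝓡 m).tangent ∞
    (fun x => (⟨x, field x⟩ : TangentBundle (𝓡 m) M))
  timelike : ∀ x, g.val x (field x) (field x) < 0

/-- A smooth curve `γ : ℝ → M` is causal if its velocity is everywhere nonzero and timelike or
lightlike. -/
def IsCausalCurve (g : LorentzianMetric m M) (γ : ℝ → M) : Prop :=
  ContMDiff 𝓘(ℝ, ℝ) (𝓡 m) ∞ γ ∧ ∀ t : ℝ,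
    (mfderiv 𝓘(ℝ, ℝ) (𝓡 m) γ t : ℝ →L[ℝ] TangentSpace (𝓡 m) (γ t)) 1 ≠ 0 ∧
    g.val (γ t) ((mfderiv 𝓘(ℝ, ℝ) (𝓡 m) γ t : ℝ →L[ℝ] TangentSpace (𝓡 m) (γ t)) 1)
      ((mfderiv 𝓘(ℝ, ℝ) (𝓡 m) γ t : ℝ →L[ℝ] TangentSpace (𝓡 m) (γ t)) 1) ≤ 0

/-- A curve `γ : ℝ → M` is inextensible if it has no endpoint on either side. (Every curve on an
open interval can be reparametrized to one on `ℝ`.) -/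
def IsInextensible (γ : ℝ → M) : Prop :=
  (¬ ∃ x, Filter.Tendsto γ Filter.atTop (𝓝 x)) ∧ ¬ ∃ x, Filter.Tendsto γ Filter.atBot (𝓝 x)

variable (m) in
/-- Smooth hypersurfaces of codimension `1` : subsets that are, near each of their points, the
zero set of a smooth function with nonzero differential. -/
def IsHypersurface (S : Set M) : Prop :=
  ∀ x ∈ S, ∃ (U : Set M) (f : M → ℝ), IsOpen U ∧ x ∈ U ∧ ContMDiffOn (𝓡 m) 𝓘(ℝ, ℝ) ∞ f U ∧
    mfderiv (𝓡 m) 𝓘(ℝ, ℝ) f x ≠ 0 ∧ S ∩ U = {z ∈ U | f z = 0}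

/-- Cauchy surfaces: hypersurfaces met exactly once by every inextensible causal curve. -/
def IsCauchySurface (g : LorentzianMetric m M) (S : Set M) : Prop :=
  IsHypersurface m S ∧
    ∀ γ : ℝ → M, IsCausalCurve g γ → IsInextensible γ → ∃! t : ℝ, γ t ∈ S

variable (m M) in
/-- The structure of an oriented and time-oriented globally hyperbolic Lorentzian manifold on the
`m`-dimensional manifold `M`. -/
structure Spacetime [IsManifold (𝓡 m) ∞ M] where
  metric : LorentzianMetric m M
  orientation : VolumeForm metric
  timeOrientation : TimeOrientation metric
  globallyHyperbolic : ∃ S : Set M, IsCauchySurface metric S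

end Spacetimes

/-! ### Chain complexes and homotopy pullbacks -/

/-- The category `Ch(ℝ)` of unbounded chain complexes of real vector spaces. -/
abbrev Ch := ChainComplex (ModuleCat.{u} ℝ) ℤ

section Complexes

/-- Fibrations of chain complexes: the degreewise surjective morphisms. -/
def IsFibration {X Y : Ch.{u}} (f : X ⟶ Y) : Prop :=
  ∀ n : ℤ, Function.Surjective (f.f n)

/-- The localization functor from chain complexes to their homotopy category, which inverts the
weak equivalences, that is, the quasi-isomorphisms. -/
abbrev toHo := (HomologicalComplex.quasiIso (ModuleCat.{u} ℝ) (ComplexShape.down ℤ)).Q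

/-- A fibrant replacement of the cospan `X ⟶ Z ⟵ Y` : a weakly equivalent cospan that
consists of fibrations. (All objects are fibrant.) -/
structure CospanReplacement {X Y Z : Ch.{u}} (f : X ⟶ Z) (g : Y ⟶ Z) where
  {X' Y' Z' : Ch.{u}}
  f' : X' ⟶ Z'
  g' : Y' ⟶ Z'
  α : X ⟶ X'
  β : Y ⟶ Y'
  γ : Z ⟶ Z'
  comm_f : f ≫ γ = α ≫ f'
  comm_g : g ≫ γ = β ≫ g'
  quasiIso_α : QuasiIso α
  quasiIso_β : QuasiIso β
  quasiIso_γ : QuasiIso γ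
  fibration_f' : IsFibration f'
  fibration_g' : IsFibration g'

/-- `P` with the legs `a : P ⟶ X` and `b : P ⟶ Y` is a model for the homotopy pullback of
`f : X ⟶ Z` and `g : Y ⟶ Z`, the right derived functor of the pullback: it is weakly
equivalent, compatibly with the legs, to the ordinary pullback of every fibrant replacement of the
cospan, and there are fibrant replacements. -/
def IsHomotopyPullback {X Y Z P : Ch.{u}} (f : X ⟶ Z) (g : Y ⟶ Z) (a : P ⟶ X) (b : P ⟶ Y) :
    Prop :=
  Nonempty (CospanReplacement f g) ∧
  ∀ R : CospanReplacement f g, ∃ e : toHo.obj P ≅ toHo.obj (pullback R.f' R.g'),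
    e.hom ≫ toHo.map (pullback.fst R.f' R.g') = toHo.map (a ≫ R.α) ∧
    e.hom ≫ toHo.map (pullback.snd R.f' R.g') = toHo.map (b ≫ R.β)

/-- The objects of a complex that is concentrated in the degrees `1, 0, -1, -2`. -/
def fourTermX (A B C D : ModuleCat.{u} ℝ) : ℤ → ModuleCat.{u} ℝ
  | .ofNat 1 => A
  | .ofNat 0 => B
  | .negSucc 0 => C
  | .negSucc 1 => D
  | _ => ModuleCat.of ℝ PUnit

/-- The differentials of `fourTerm`. -/
def fourTermD {A B C D : ModuleCat.{u} ℝ} (a : A ⟶ B) (b : B ⟶ C) (c : C ⟶ D) :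
    ∀ n : ℤ, fourTermX A B C D (n + 1) ⟶ fourTermX A B C D n
  | .ofNat 0 => a
  | .negSucc 0 => b
  | .negSucc 1 => c
  | .ofNat (_ + 1) => 0
  | .negSucc (_ + 2) => 0

/-- The chain complex `D ⟵ C ⟵ B ⟵ A` in the degrees `-2, -1, 0, 1`, zero in all others. -/
def fourTerm {A B C D : ModuleCat.{u} ℝ} (a : A ⟶ B) (b : B ⟶ C) (c : C ⟶ D)
    (hab : a ≫ b = 0) (hbc : b ≫ c = 0) : Ch.{u} :=
  ChainComplex.of (fourTermX A B C D) (fourTermD a b c) fun n =>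
    match n with
    | .ofNat 0 => zero_comp
    | .ofNat (_ + 1) => comp_zero
    | .negSucc 0 => hab
    | .negSucc 1 => hbc
    | .negSucc (_ + 2) => comp_zero

theorem fourTerm_d {A B C D : ModuleCat.{u} ℝ} (a : A ⟶ B) (b : B ⟶ C) (c : C ⟶ D)
    (hab : a ≫ b = 0) (hbc : b ≫ c = 0) (n : ℤ) :
    (fourTerm a b c hab hbc).d (n + 1) n = fourTermD a b c n :=
  ChainComplex.of_d _ _ _

/-- The components of `fourTermHom`. -/
def fourTermHomF {A B C D A' B' C' D' : ModuleCat.{u} ℝ} (f₁ : A ⟶ A') (f₀ : B ⟶ B')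
    (e₁ : C ⟶ C') (e₂ : D ⟶ D') : ∀ n : ℤ, fourTermX A B C D n ⟶ fourTermX A' B' C' D' n
  | .ofNat 1 => f₁
  | .ofNat 0 => f₀
  | .negSucc 0 => e₁
  | .negSucc 1 => e₂
  | .ofNat (_ + 2) => 0
  | .negSucc (_ + 2) => 0

/-- The chain map with the components `f₁, f₀, e₁, e₂` in the degrees `1, 0, -1, -2`. -/
def fourTermHom {A B C D A' B' C' D' : ModuleCat.{u} ℝ}
    {a : A ⟶ B} {b : B ⟶ C} {c : C ⟶ D} {hab : a ≫ b = 0} {hbc : b ≫ c = 0}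
    {a' : A' ⟶ B'} {b' : B' ⟶ C'} {c' : C' ⟶ D'} {hab' : a' ≫ b' = 0} {hbc' : b' ≫ c' = 0}
    (f₁ : A ⟶ A') (f₀ : B ⟶ B') (e₁ : C ⟶ C') (e₂ : D ⟶ D')
    (h₁ : f₁ ≫ a' = a ≫ f₀) (h₀ : f₀ ≫ b' = b ≫ e₁) (k₁ : e₁ ≫ c' = c ≫ e₂) :
    fourTerm a b c hab hbc ⟶ fourTerm a' b' c' hab' hbc' :=
  ChainComplex.ofHom (fourTermHomF f₁ f₀ e₁ e₂) fun n => by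
    have h : fourTermHomF f₁ f₀ e₁ e₂ (n + 1) ≫ fourTermD a' b' c' n =
        fourTermD a b c n ≫ fourTermHomF f₁ f₀ e₁ e₂ n :=
      match n with
      | .ofNat 0 => h₁
      | .ofNat (_ + 1) => comp_zero.trans zero_comp.symm
      | .negSucc 0 => h₀
      | .negSucc 1 => k₁
      | .negSucc (_ + 2) => comp_zero.trans zero_comp.symm
    rw [fourTerm_d, fourTerm_d]
    exact h

end Complexes

/-! ### Abelian Yang-Mills theory -/

section YangMillsTheory
variable {m : ℕ} {M : Type u} [TopologicalSpace M] [ChartedSpace (Model m) M]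
  [IsManifold (𝓡 m) ∞ M]

variable (m M) in
/-- The vector space `Ωᵖ(M)` as an object of the category of vector spaces. -/
abbrev Om (p : ℕ) : ModuleCat.{u} ℝ := ModuleCat.of ℝ (DiffForm m p M)

/-- The zero vector space. -/
abbrev zeroMod : ModuleCat.{u} ℝ := ModuleCat.of ℝ PUnit

variable (m M) in
/-- `d : Ω⁰(M) → Ω¹(M)`. -/
def d₀ : Om m M 0 ⟶ Om m M 1 := ModuleCat.ofHom (extD 0)

/-- `δ : Ω¹(M) → Ω⁰(M)`. -/
def δ₁ (hm : 2 ≤ m) (S : Spacetime m M) : Om m M 1 ⟶ Om m M 0 :=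
  ModuleCat.ofHom (codiff (p := 0) (q := m - 1) (by omega) S.metric S.orientation)

/-- The Yang-Mills operator `δd : Ω¹(M) → Ω¹(M)`. -/
def δd (hm : 2 ≤ m) (S : Spacetime m M) : Om m M 1 ⟶ Om m M 1 :=
  ModuleCat.ofHom (codiff (p := 1) (q := m - 2) (by omega) S.metric S.orientation ∘ₗ extD 1)

theorem d₀_δd (hm : 2 ≤ m) (S : Spacetime m M) : d₀ m M ≫ δd hm S = 0 := by
  ext α : 2
  change codiff _ _ _ (extD 1 (extD 0 α)) = 0
  rw [extD_extD, map_zero]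

theorem δd_δ₁ (hm : 2 ≤ m) (S : Spacetime m M) : δd hm S ≫ δ₁ hm S = 0 := by
  ext α : 2
  have h := codiff_codiff (p := 0) (q := m - 2) (r := m - 1) (by omega) (by omega) S.metric
    S.orientation (extD 1 α)
  exact h

variable (m M) in
/-- The complex of fields `𝔉 = (Ω¹(M) ⟵ Ω⁰(M))`, with differential `d`, in the degrees
`0` and `1`. -/
def fields : Ch.{u} :=
  fourTerm (d₀ m M) (0 : Om m M 1 ⟶ zeroMod) (0 : zeroMod ⟶ zeroMod) comp_zero comp_zero

/-- The smooth dual `𝔉* = (Ω⁰(M) ⟵ Ω¹(M))`, with differential `-δ`, in the degrees `-1`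
and `0`. -/
def dualFields (hm : 2 ≤ m) (S : Spacetime m M) : Ch.{u} :=
  fourTerm (0 : zeroMod ⟶ Om m M 1) (-δ₁ hm S) (0 : Om m M 0 ⟶ zeroMod) zero_comp comp_zero

/-- The cotangent bundle `T*𝔉 = 𝔉 × 𝔉*`. -/
abbrev cotangent (hm : 2 ≤ m) (S : Spacetime m M) : Ch.{u} :=
  fields m M ⨯ dualFields hm S

/-- The fibre component `𝔉 → 𝔉*` of the variation of the action, which is `δd` in degree `0`. -/
def variation (hm : 2 ≤ m) (S : Spacetime m M) : fields m M ⟶ dualFields hm S :=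
  fourTermHom 0 (δd hm S) 0 0
    (by rw [zero_comp, d₀_δd]) (by rw [Preadditive.comp_neg, δd_δ₁, neg_zero, comp_zero])
    (by rw [zero_comp, zero_comp])

/-- The variation `dS : 𝔉 → T*𝔉` of the Yang-Mills action: `(id, δd)` in degree `0` and `id` in
degree `1`. -/
def dS (hm : 2 ≤ m) (S : Spacetime m M) : fields m M ⟶ cotangent hm S :=
  prod.lift (𝟙 _) (variation hm S)

/-- The zero section `𝔉 → T*𝔉`. -/
def zeroSection (hm : 2 ≤ m) (S : Spacetime m M) : fields m M ⟶ cotangent hm S :=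
  prod.lift (𝟙 _) 0

/-- The complex `Ω⁰(M) ⟵ Ω¹(M) ⟵ Ω¹(M) ⟵ Ω⁰(M)`, with the differentials `δ`, `δd`, `d`, in
the degrees `-2, -1, 0, 1`. -/
def Sol (hm : 2 ≤ m) (S : Spacetime m M) : Ch.{u} :=
  fourTerm (d₀ m M) (δd hm S) (δ₁ hm S) (d₀_δd hm S) (δd_δ₁ hm S)

/-- The projection `Sol → 𝔉`, the identity in the degrees `0` and `1`. -/
def solToFields (hm : 2 ≤ m) (S : Spacetime m M) : Sol hm S ⟶ fields m M :=
  fourTermHom (𝟙 _) (𝟙 _) 0 0 (by rw [Category.id_comp, Category.comp_id])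
    (by rw [comp_zero, comp_zero]) (by rw [comp_zero, comp_zero])

end YangMillsTheory

end YangMills
end

/-! A point of the homotopy pullback of `dS` and the zero section consists of two fields x and y
together with a path in T*𝔉 from (x, δd x) to (y, 0). The base component of the path identifies x
with y, so what remains is a field x with a null-homotopy of its image under v = `variation` : 𝔉 →
𝔉*. The homotopy pullback is therefore the homotopy fibre of v, whose chain groups are 𝔉ₙ × 𝔉*ₙ₊₁.
Here one of the two factors vanishes in every degree: the degrees 1 and 0 contain only fields, the
degrees -1 and -2 only antifields, and v becomes the differential δd between them. This is `Sol`.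
The shift by one degree changes the sign of the differential of 𝔉*, which turns -δ into δ.

In formulas, the identity on the antifields is a chain homotopy h from `solToFields` ≫ v to 0
(`solToFields_variation`), and the pair formed by `solToFields` and h is bijective in every degree
(`solHomotopy_injective`, `solHomotopy_surjective`). By `isHomotopyPullback_graph_zero` this is
enough.

The general criterion behind it, `isHomotopyPullback_of_homotopy`, has to compare P with the strict
pullback of an arbitrary fibrant replacement. A square that commutes only up to homotopy is made
strictly commutative there by lifting the homotopy through a fibration and changing one leg by the
resulting null-homotopic map, which is invisible in the homotopy category. The induced map to the
pullback is a quasi-isomorphism by a diagram chase, based on the elementwise criterion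
`quasiIso_iff_exists_lift`. A fibrant replacement exists because a contractible complex that
surjects onto the target can be added to each source (`diskReplacement`). -/

namespace YangMills

/-! ### Quasi-isomorphisms in terms of elements -/

section ElementCriterion

variable {K L : Ch.{u}}

theorem d_d_apply (K : Ch.{u}) (i j k : ℤ) (x : K.X i) : K.d j k (K.d i j x) = 0 := by
  rw [← ModuleCat.comp_apply, K.d_comp_d]
  rfl

theorem f_d_apply (φ : K ⟶ L) (i j : ℤ) (x : K.X i) : φ.f j (K.d i j x) = L.d i j (φ.f i x) := by
  rw [← ModuleCat.comp_apply, ← ModuleCat.comp_apply, φ.comm]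

theorem exists_cycles (K : Ch.{u}) {i j : ℤ} (hij : j + 1 = i) (x : K.X i) (hx : K.d i j x = 0) :
    ∃ z : K.cycles i, K.iCycles i z = x :=
  (ShortComplex.moduleCat_exact_iff _).1
    (ShortComplex.exact_of_f_is_kernel (ShortComplex.mk (K.iCycles i) (K.d i j) (by simp))
      (K.cyclesIsKernel i j ((ComplexShape.down ℤ).next_eq' hij))) x hx

theorem iCycles_injective (K : Ch.{u}) (i : ℤ) : Function.Injective (K.iCycles i) :=
  (ModuleCat.mono_iff_injective _).1 inferInstance

theorem d_iCycles_apply (K : Ch.{u}) (i j : ℤ) (z : K.cycles i) : K.d i j (K.iCycles i z) = 0 := by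
  rw [← ModuleCat.comp_apply, K.iCycles_d]
  rfl

theorem homologyπ_surjective (K : Ch.{u}) (i : ℤ) : Function.Surjective (K.homologyπ i) :=
  (ModuleCat.epi_iff_surjective _).1 inferInstance

/-- Homology is the cokernel of the map from chains to cycles, and the inclusion of cycles into
chains is injective, so the equation may be tested in the chain group. -/
theorem homologyπ_eq_zero_iff (K : Ch.{u}) {i j : ℤ} (hij : i + 1 = j) (z : K.cycles i) :
    K.homologyπ i z = 0 ↔ ∃ x : K.X j, K.d j i x = K.iCycles i z := by
  have hex := ShortComplex.exact_of_g_is_cokernel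
    (ShortComplex.mk (K.toCycles j i) (K.homologyπ i) (by simp))
      (K.homologyIsCokernel j i ((ComplexShape.down ℤ).prev_eq' hij))
  have hd : ∀ x : K.X j, K.iCycles i (K.toCycles j i x) = K.d j i x := fun x => by
    rw [← ModuleCat.comp_apply, K.toCycles_i]
  constructor
  · intro h
    obtain ⟨x, hx⟩ := (ShortComplex.moduleCat_exact_iff _).1 hex z h
    exact ⟨x, by rw [← hd, ← hx]⟩
  · rintro ⟨x, hx⟩
    rw [← hd] at hx
    rw [← iCycles_injective K i hx, ← ModuleCat.comp_apply, K.toCycles_comp_homologyπ]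
    rfl

/-- A chain map is a quasi-isomorphism if and only if its mapping cone is exact. -/
theorem quasiIso_iff_exists_lift (φ : K ⟶ L) :
    QuasiIso φ ↔ ∀ i j k l : ℤ, i + 1 = j → j + 1 = k → k + 1 = l →
      ∀ (x : K.X j) (y : L.X k), K.d j i x = 0 → φ.f j x = L.d k j y →
        ∃ (x' : K.X k) (y' : L.X l), K.d k j x' = x ∧ y = φ.f k x' + L.d l k y' := by
  have hπ : ∀ i (z : K.cycles i), HomologicalComplex.homologyMap φ i (K.homologyπ i z) =
      L.homologyπ i (HomologicalComplex.cyclesMap φ i z) := fun i z => by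
    rw [← ModuleCat.comp_apply, ← ModuleCat.comp_apply, HomologicalComplex.homologyπ_naturality]
  have hι : ∀ i (z : K.cycles i), L.iCycles i (HomologicalComplex.cyclesMap φ i z) =
      φ.f i (K.iCycles i z) := fun i z => by
    rw [← ModuleCat.comp_apply, ← ModuleCat.comp_apply, HomologicalComplex.cyclesMap_i]
  have hbij : QuasiIso φ ↔
      ∀ i, Function.Bijective (HomologicalComplex.homologyMap φ i) := by
    simp_rw [_root_.quasiIso_iff, quasiIsoAt_iff_isIso_homologyMap,
      ConcreteCategory.isIso_iff_bijective]
  rw [hbij]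
  constructor
  · intro h i j k l hij hjk hkl x y hx hxy
    -- Injectivity on homology in degree `j` makes `x` a boundary `d x₁`. Then `y - φ x₁` is a
    -- cycle, and surjectivity in degree `k` gives a cycle by which `x₁` must be corrected.
    obtain ⟨z, rfl⟩ := exists_cycles K hij x hx
    have hz : K.homologyπ j z = 0 := by
      apply (h j).1
      rw [hπ, map_zero, homologyπ_eq_zero_iff L hjk]
      exact ⟨y, by rw [hι, hxy]⟩
    obtain ⟨x₁, hx₁⟩ := (homologyπ_eq_zero_iff K hjk z).1 hz
    obtain ⟨w, hw⟩ := exists_cycles L hjk (y - φ.f k x₁)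
      (by rw [map_sub, ← f_d_apply, hx₁, hxy, sub_self])
    obtain ⟨c, hc⟩ := (h k).2 (L.homologyπ k w)
    obtain ⟨c, rfl⟩ := homologyπ_surjective K k c
    obtain ⟨y', hy'⟩ := (homologyπ_eq_zero_iff L hkl (w - HomologicalComplex.cyclesMap φ k c)).1
      (by rw [map_sub, ← hπ, hc, sub_self])
    refine ⟨x₁ + K.iCycles k c, y', by rw [map_add, hx₁, d_iCycles_apply, add_zero], ?_⟩
    rw [hy', map_sub, hw, hι, map_add]
    abel
  · intro h i
    constructor
    · rw [injective_iff_map_eq_zero]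
      intro c hc
      obtain ⟨z, rfl⟩ := homologyπ_surjective K i c
      rw [hπ, homologyπ_eq_zero_iff L rfl] at hc
      obtain ⟨y, hy⟩ := hc
      rw [hι] at hy
      -- Injectivity needs only the first half of the conclusion: a cycle whose image bounds is
      -- itself a boundary.
      obtain ⟨x', -, hx', -⟩ := h (i - 1) i (i + 1) (i + 1 + 1) (by ring) rfl rfl _ y
        (d_iCycles_apply K i _ z) hy.symm
      exact (homologyπ_eq_zero_iff K rfl z).2 ⟨x', hx'⟩
    · intro c
      obtain ⟨w, rfl⟩ := homologyπ_surjective L i c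
      -- Surjectivity is the case `x = 0`: the given chain is then a cycle of `L`, and the chain
      -- `x'` obtained is a cycle of `K`.
      obtain ⟨x', y', hx', hy'⟩ := h (i - 1 - 1) (i - 1) i (i + 1) (by ring) (by ring) rfl 0
        (L.iCycles i w) (map_zero _) (by rw [map_zero, d_iCycles_apply])
      obtain ⟨z, rfl⟩ := exists_cycles K (by ring) x' hx'
      refine ⟨K.homologyπ i z, ?_⟩
      rw [hπ, eq_comm, ← sub_eq_zero, ← map_sub]
      refine (homologyπ_eq_zero_iff L rfl _).2 ⟨y', ?_⟩
      rw [map_sub, hι, hy']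
      abel

end ElementCriterion

/-! ### Existence of fibrant replacements -/

section Replacement

/-- The differential of `disk`. -/
def diskD (Z : Ch.{u}) (n : ℤ) : ModuleCat.of ℝ (Z.X (n + 1) × Z.X (n + 1 + 1)) ⟶
    ModuleCat.of ℝ (Z.X n × Z.X (n + 1)) :=
  ModuleCat.ofHom (LinearMap.prod ((Z.d (n + 1) n).hom ∘ₗ LinearMap.fst ℝ _ _)
    (LinearMap.fst ℝ _ _ - (Z.d (n + 1 + 1) (n + 1)).hom ∘ₗ LinearMap.snd ℝ _ _))

/-- The contractible complex with the chain groups `Zₙ × Zₙ₊₁` and the differential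
`(z, w) ↦ (dz, z - dw)`, which projects onto `Z`. -/
def disk (Z : Ch.{u}) : Ch.{u} :=
  ChainComplex.of (fun n => ModuleCat.of ℝ (Z.X n × Z.X (n + 1))) (diskD Z) fun n => by
    refine ModuleCat.hom_ext (LinearMap.ext fun x => ?_)
    refine Prod.ext (d_d_apply Z _ _ _ x.1) ?_
    change Z.d (n + 1 + 1) (n + 1) x.1 - Z.d (n + 1 + 1) (n + 1)
      (x.1 - Z.d (n + 1 + 1 + 1) (n + 1 + 1) x.2) = 0
    rw [map_sub, d_d_apply, sub_zero, sub_self]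

theorem disk_d (Z : Ch.{u}) (n : ℤ) : (disk Z).d (n + 1) n = diskD Z n :=
  ChainComplex.of_d (fun n => ModuleCat.of ℝ (Z.X n × Z.X (n + 1))) (diskD Z) n

/-- The projection of `disk Z` onto `Z`. -/
def diskProj (Z : Ch.{u}) : disk Z ⟶ Z where
  f n := ModuleCat.ofHom (LinearMap.fst ℝ (Z.X n) (Z.X (n + 1)))
  comm' := by
    rintro _ n rfl
    rw [disk_d]
    rfl

theorem diskProj_isFibration (Z : Ch.{u}) : IsFibration (diskProj Z) :=
  fun _ z => ⟨(z, 0), rfl⟩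

/-- The map `(z, w) ↦ (w, 0)` is a contraction: for a cycle the second component of the differential
forces `z = dw`, and then `(z, w) = d(w, 0)`. -/
theorem disk_exact (Z : Ch.{u}) {i j k : ℤ} (hij : i + 1 = j) (hjk : j + 1 = k)
    (x : (disk Z).X j) (hx : (disk Z).d j i x = 0) : ∃ y, (disk Z).d k j y = x := by
  subst hij hjk
  rw [disk_d] at hx
  have hx : x.1 - Z.d (i + 1 + 1) (i + 1) x.2 = 0 := congrArg Prod.snd hx
  rw [disk_d]
  refine ⟨((x.2, 0) : Z.X (i + 1 + 1) × Z.X (i + 1 + 1 + 1)), Prod.ext (sub_eq_zero.1 hx).symm ?_⟩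
  change x.2 - Z.d _ _ 0 = x.2
  rw [map_zero, sub_zero]

theorem comp_f_apply {X Y Z : Ch.{u}} (f : X ⟶ Y) (g : Y ⟶ Z) (n : ℤ) (x : X.X n) :
    (f ≫ g).f n x = g.f n (f.f n x) := rfl

/-- The complementary summand is exact, so a chain whose boundary lies in `X` differs from its
`X`-component by a boundary in the disk. -/
theorem quasiIso_biprod_inl_disk (X Z : Ch.{u}) : QuasiIso (biprod.inl : X ⟶ X ⊞ disk Z) := by
  let p : X ⊞ disk Z ⟶ X := biprod.fst
  let q : X ⊞ disk Z ⟶ disk Z := biprod.snd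
  let ι : X ⟶ X ⊞ disk Z := biprod.inl
  let κ : disk Z ⟶ X ⊞ disk Z := biprod.inr
  have h₁ : ∀ n x, p.f n (ι.f n x) = x := fun n x => by
    rw [← comp_f_apply, biprod.inl_fst]
    rfl
  have h₂ : ∀ n x, q.f n (ι.f n x) = 0 := fun n x => by
    rw [← comp_f_apply, biprod.inl_snd]
    rfl
  have h₃ : ∀ n y, y = ι.f n (p.f n y) + κ.f n (q.f n y) := fun n y =>
    (congrArg (fun φ : X ⊞ disk Z ⟶ X ⊞ disk Z => φ.f n y) biprod.total).symm
  rw [quasiIso_iff_exists_lift]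
  intro i j k l hij hjk hkl x y hx hxy
  change ι.f j x = _ at hxy
  obtain ⟨w, hw⟩ := disk_exact Z hjk hkl (q.f k y) (by rw [← f_d_apply, ← hxy, h₂])
  refine ⟨p.f k y, κ.f l w, by rw [← f_d_apply, ← hxy, h₁], ?_⟩
  rw [← f_d_apply, hw]
  exact h₃ k y

theorem biprod_desc_disk_isFibration {X Z : Ch.{u}} (f : X ⟶ Z) :
    IsFibration (biprod.desc f (diskProj Z)) := fun n z => by
  obtain ⟨w, hw⟩ := diskProj_isFibration Z n z
  refine ⟨(biprod.inr : disk Z ⟶ X ⊞ disk Z).f n w, ?_⟩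
  rw [← comp_f_apply, biprod.inr_desc, hw]

/-- The fibrant replacement of a cospan that adds disks to its two sources. -/
noncomputable def diskReplacement {X Y Z : Ch.{u}} (f : X ⟶ Z) (g : Y ⟶ Z) :
    CospanReplacement f g where
  f' := biprod.desc f (diskProj Z)
  g' := biprod.desc g (diskProj Z)
  α := biprod.inl
  β := biprod.inl
  γ := 𝟙 Z
  comm_f := by rw [biprod.inl_desc, Category.comp_id]
  comm_g := by rw [biprod.inl_desc, Category.comp_id]
  quasiIso_α := quasiIso_biprod_inl_disk X Z
  quasiIso_β := quasiIso_biprod_inl_disk Y Z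
  quasiIso_γ := inferInstance
  fibration_f' := biprod_desc_disk_isFibration f
  fibration_g' := biprod_desc_disk_isFibration g

end Replacement

/-! ### Homotopy commutative squares and homotopy pullbacks -/

section HomotopyPullback

variable {X Y Z P : Ch.{u}}

theorem exists_comp_eq_of_surjective {U V W : Type*} [AddCommGroup U] [Module ℝ U]
    [AddCommGroup V] [Module ℝ V] [AddCommGroup W] [Module ℝ W] (p : U →ₗ[ℝ] V)
    (hp : Function.Surjective p) (f : W →ₗ[ℝ] V) : ∃ s : W →ₗ[ℝ] U, p ∘ₗ s = f := by
  obtain ⟨r, hr⟩ := p.exists_rightInverse_of_surjective (LinearMap.range_eq_top.2 hp)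
  exact ⟨r ∘ₗ f, by rw [← LinearMap.comp_assoc, hr, LinearMap.id_comp]⟩

/-- Over a field every surjection splits. Homotopies can therefore be lifted through fibrations
degree by degree, since their components satisfy no compatibility with the differentials. -/
theorem exists_lift_of_surjective {U V W : ModuleCat.{u} ℝ} (p : U ⟶ V)
    (hp : Function.Surjective p) (f : W ⟶ V) : ∃ s : W ⟶ U, s ≫ p = f := by
  obtain ⟨s, hs⟩ := exists_comp_eq_of_surjective p.hom hp f.hom
  exact ⟨ModuleCat.ofHom s, ModuleCat.hom_ext hs⟩

/-- The null-homotopic chain map `dh + hd`. -/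
noncomputable def homotopyBoundary {K L : Ch.{u}} (h : ∀ i j : ℤ, i + 1 = j → (K.X i ⟶ L.X j)) :
    K ⟶ L :=
  Homotopy.nullHomotopicMap' (c := ComplexShape.down ℤ) h

theorem homotopyBoundary_f {K L : Ch.{u}} (h : ∀ i j : ℤ, i + 1 = j → (K.X i ⟶ L.X j))
    {i j k : ℤ} (hij : i + 1 = j) (hjk : j + 1 = k) :
    (homotopyBoundary h).f j = K.d j i ≫ h i j hij + h j k hjk ≫ L.d k j :=
  Homotopy.nullHomotopicMap'_f (c := ComplexShape.down ℤ) hjk hij h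

theorem homotopyBoundary_f_apply {K L : Ch.{u}} (h : ∀ i j : ℤ, i + 1 = j → (K.X i ⟶ L.X j))
    {i j k : ℤ} (hij : i + 1 = j) (hjk : j + 1 = k) (x : K.X j) :
    (homotopyBoundary h).f j x = h i j hij (K.d j i x) + L.d k j (h j k hjk x) := by
  rw [homotopyBoundary_f h hij hjk]
  rfl

theorem homotopyBoundary_comp {K L N : Ch.{u}} (h : ∀ i j : ℤ, i + 1 = j → (K.X i ⟶ L.X j))
    (g : L ⟶ N) : homotopyBoundary h ≫ g = homotopyBoundary fun i j hij => h i j hij ≫ g.f j :=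
  Homotopy.nullHomotopicMap'_comp (c := ComplexShape.down ℤ) h g

/-- Chain homotopic maps become equal after inverting the quasi-isomorphisms. -/
theorem toHo_map_homotopyBoundary_sub {K L : Ch.{u}} (f : K ⟶ L)
    (h : ∀ i j : ℤ, i + 1 = j → (K.X i ⟶ L.X j)) :
    toHo.map (f - homotopyBoundary h) = toHo.map f := by
  have H : Homotopy (f - homotopyBoundary h) f :=
    (Homotopy.equivSubZero.symm ((Homotopy.ofEq (by abel)).trans
      (Homotopy.nullHomotopy' (c := ComplexShape.down ℤ) h))).symm
  exact (ComplexShape.QFactorsThroughHomotopy.areEqualizedByLocalization H).map_eq toHo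

/-- The pullback embeds into the biproduct `X ⊞ Y`, and monomorphisms of complexes are injective in
each degree. -/
theorem pullback_ext {f : X ⟶ Z} {g : Y ⟶ Z} {n : ℤ} {q q' : (pullback f g).X n}
    (h₁ : (pullback.fst f g).f n q = (pullback.fst f g).f n q')
    (h₂ : (pullback.snd f g).f n q = (pullback.snd f g).f n q') : q = q' := by
  have hinj : Mono (biprod.lift (pullback.fst f g) (pullback.snd f g)) := by
    refine ⟨fun a b hab => pullback.hom_ext ?_ ?_⟩
    · simpa using hab =≫ biprod.fst
    · simpa using hab =≫ biprod.snd
  have hn : Mono ((biprod.lift (pullback.fst f g) (pullback.snd f g)).f n) := inferInstance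
  refine (ModuleCat.mono_iff_injective _).1 hn ?_
  have hl : ∀ q : (pullback f g).X n, (biprod.lift (pullback.fst f g) (pullback.snd f g)).f n q =
      (biprod.inl : X ⟶ X ⊞ Y).f n ((pullback.fst f g).f n q) +
      (biprod.inr : Y ⟶ X ⊞ Y).f n ((pullback.snd f g).f n q) := fun q => by
    rw [biprod.lift_eq]
    rfl
  rw [hl, hl, h₁, h₂]

/-- Evaluation in a degree preserves pullbacks, and an element of a vector space is a linear map
from `ℝ`, lifted here to the universe of the complexes. -/
theorem exists_pullback {f : X ⟶ Z} {g : Y ⟶ Z} {n : ℤ} (x : X.X n) (y : Y.X n)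
    (hxy : f.f n x = g.f n y) : ∃ q : (pullback f g).X n,
      (pullback.fst f g).f n q = x ∧ (pullback.snd f g).f n q = y := by
  let F := HomologicalComplex.eval (ModuleCat.{u} ℝ) (ComplexShape.down ℤ) n
  have sq : IsPullback (F.map (pullback.fst f g)) (F.map (pullback.snd f g)) (F.map f) (F.map g) :=
    (IsPullback.of_hasPullback f g).map F
  let a : ModuleCat.of ℝ (ULift.{u} ℝ) ⟶ X.X n :=
    ModuleCat.ofHom (LinearMap.toSpanSingleton ℝ (X.X n) x ∘ₗ ULift.moduleEquiv.toLinearMap)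
  let b : ModuleCat.of ℝ (ULift.{u} ℝ) ⟶ Y.X n :=
    ModuleCat.ofHom (LinearMap.toSpanSingleton ℝ (Y.X n) y ∘ₗ ULift.moduleEquiv.toLinearMap)
  have hab : a ≫ F.map f = b ≫ F.map g := by
    refine ModuleCat.hom_ext (LinearMap.ext fun r => ?_)
    change f.f n (r.down • x) = g.f n (r.down • y)
    rw [map_smul, map_smul, hxy]
  refine ⟨sq.lift a b hab ⟨1⟩, ?_, ?_⟩
  · exact (congrArg (fun φ => φ.hom (⟨1⟩ : ULift.{u} ℝ)) (sq.lift_fst a b hab)).trans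
      (one_smul ℝ x)
  · exact (congrArg (fun φ => φ.hom (⟨1⟩ : ULift.{u} ℝ)) (sq.lift_snd a b hab)).trans
      (one_smul ℝ y)

/-- A square that commutes up to a chain homotopy `h` is a homotopy pullback if the induced map from
`P` to the homotopy fibre product of `f` and `g`, with the chain groups `Xₙ × Yₙ × Zₙ₊₁`, has an
exact mapping cone. -/
theorem isHomotopyPullback_of_homotopy (f : X ⟶ Z) (g : Y ⟶ Z) (a : P ⟶ X) (b : P ⟶ Y)
    (h : ∀ i j : ℤ, i + 1 = j → (P.X i ⟶ Z.X j))
    (hcomm : a ≫ f - b ≫ g = homotopyBoundary h)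
    -- This is the criterion `quasiIso_iff_exists_lift` for `p ↦ (a p, b p, -h p)`, where the
    -- homotopy fibre product has the differential `(x, y, z) ↦ (dx, dy, -f x + g y - dz)`. The sign
    -- of `z'` is reversed, which is harmless under the existential quantifier.
    (hlift : ∀ i j k l n : ℤ, i + 1 = j → ∀ hjk : j + 1 = k, ∀ hkl : k + 1 = l, l + 1 = n →
      ∀ (p : P.X j) (x : X.X k) (y : Y.X k) (z : Z.X l), P.d j i p = 0 → a.f j p = X.d k j x →
        b.f j p = Y.d k j y → h j k hjk p - f.f k x + g.f k y = Z.d l k z →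
        ∃ (p' : P.X k) (x' : X.X l) (y' : Y.X l) (z' : Z.X n), P.d k j p' = p ∧
          x = a.f k p' + X.d l k x' ∧ y = b.f k p' + Y.d l k y' ∧
          z = - h k l hkl p' - f.f l x' + g.f l y' + Z.d n l z') :
    IsHomotopyPullback f g a b := by
  refine ⟨⟨diskReplacement f g⟩, fun R => ?_⟩
  obtain ⟨f', g', α, β, γ, hf, hg, qα, qβ, qγ, Ff, Fg⟩ := R
  rename_i X' Y' Z'
  dsimp only
  have hf' : ∀ n x, γ.f n (f.f n x) = f'.f n (α.f n x) := fun n x => by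
    rw [← comp_f_apply, hf, comp_f_apply]
  have hg' : ∀ n x, γ.f n (g.f n x) = g'.f n (β.f n x) := fun n x => by
    rw [← comp_f_apply, hg, comp_f_apply]
  -- The homotopy `h`, pushed to `Z'`, is lifted along the fibration `f'` to a homotopy `s` with
  -- values in `X'`.
  choose s hs using fun (i j : ℤ) (hij : i + 1 = j) => exists_lift_of_surjective (f'.f j) (Ff j) (h i j hij ≫ γ.f j)
  have hs' : ∀ i j hij p, f'.f j (s i j hij p) = γ.f j (h i j hij p) := fun i j hij p =>
    congrArg (fun φ => φ.hom p) (hs i j hij)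
  have hK : homotopyBoundary s ≫ f' = homotopyBoundary h ≫ γ := by
    simp_rw [homotopyBoundary_comp, hs]
  -- Subtracting the boundary of `s` from the first leg removes exactly the defect of commutativity.
  have hQ : (a ≫ α - homotopyBoundary s) ≫ f' = (b ≫ β) ≫ g' := by
    rw [Preadditive.sub_comp, hK, ← hcomm, Preadditive.sub_comp, Category.assoc, Category.assoc,
      Category.assoc, Category.assoc, hf, hg, sub_sub_cancel]
  let φ : P ⟶ pullback f' g' := pullback.lift _ _ hQ
  have hfst : ∀ {i j k : ℤ} (hij : i + 1 = j) (hjk : j + 1 = k) (p : P.X j),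
      (pullback.fst f' g').f j (φ.f j p) =
        α.f j (a.f j p) - (s i j hij (P.d j i p) + X'.d k j (s j k hjk p)) := by
    intro i j k hij hjk p
    rw [← comp_f_apply, pullback.lift_fst, ← homotopyBoundary_f_apply]
    rfl
  have hsnd : ∀ j (p : P.X j), (pullback.snd f' g').f j (φ.f j p) = β.f j (b.f j p) := by
    intro j p
    rw [← comp_f_apply, pullback.lift_snd]
    rfl
  have hd : ∀ {i j k : ℤ} (hij : i + 1 = j) (hjk : j + 1 = k) (p : P.X j),
      Z.d k j (h j k hjk p) = f.f j (a.f j p) - g.f j (b.f j p) - h i j hij (P.d j i p) := by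
    intro i j k hij hjk p
    rw [eq_sub_iff_add_eq, add_comm, ← homotopyBoundary_f_apply, ← hcomm]
    rfl
  have hφ : QuasiIso φ := by
    rw [quasiIso_iff_exists_lift] at qα qβ qγ ⊢
    intro i j k l hij hjk hkl p q hp hpq
    set x' := (pullback.fst f' g').f k q with hx'
    set y' := (pullback.snd f' g').f k q with hy'
    have hxy' : f'.f k x' = g'.f k y' := by
      rw [hx', hy', ← comp_f_apply, pullback.condition, comp_f_apply]
    have e₁ : α.f j (a.f j p) = X'.d k j (x' + s j k hjk p) := by
      have := congrArg ((pullback.fst f' g').f j) hpq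
      rw [hfst hij hjk, f_d_apply, hp, map_zero, zero_add, sub_eq_iff_eq_add] at this
      rw [this, map_add]
    have e₂ : β.f j (b.f j p) = Y'.d k j y' := by
      rw [← hsnd, hpq, f_d_apply]
    obtain ⟨x, x'', hx, hx''⟩ := qα i j k l hij hjk hkl _ _ (by rw [← f_d_apply, hp, map_zero]) e₁
    obtain ⟨y, y'', hy, hy''⟩ := qβ i j k l hij hjk hkl _ _ (by rw [← f_d_apply, hp, map_zero]) e₂
    -- After descending the two components of `q` to `x` and `y`, the gap between `f x` and `g y` is
    -- also descended, one degree higher: the chain `h p - f x + g y` is a cycle in `Z` and its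
    -- image in `Z'` is the boundary of `f' x'' - g' y''`.
    obtain ⟨z, z'', hz, hz''⟩ := qγ j k l (l + 1) hjk hkl rfl
      (h j k hjk p - f.f k x + g.f k y) (f'.f l x'' - g'.f l y'')
      (by
        rw [map_add, map_sub, hd hij hjk, hp, ← f_d_apply, ← f_d_apply, hx, hy, map_zero]
        abel)
      (by
        rw [map_sub, ← f_d_apply, ← f_d_apply, map_add, map_sub, hf', hg', ← hs',
          eq_sub_of_add_eq hx''.symm, eq_sub_of_add_eq hy''.symm]
        simp only [map_sub, map_add, hxy']
        abel)
    obtain ⟨p₁, x₁, y₁, z₁, hp₁, hx₁, hy₁, hz₁⟩ :=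
      hlift i j k l (l + 1) hij hjk hkl rfl p x y z hp hx.symm hy.symm hz.symm
    -- The two candidate components of `q'` have images in `Z'` that differ by the boundary of `γ z₁
    -- + z''`. Lifting this chain to `w` and subtracting `d w` makes them agree, without changing
    -- the boundary of the first component.
    obtain ⟨w, hw⟩ := Ff (l + 1) (γ.f (l + 1) z₁ + z'')
    obtain ⟨q', hq₁, hq₂⟩ := exists_pullback (f := f') (g := g')
      (α.f l x₁ + x'' + s k l hkl p₁ - X'.d (l + 1) l w) (β.f l y₁ + y'') (by
        rw [map_sub, map_add, map_add, map_add, f_d_apply, hw, hs', ← hf', ← hg', map_add,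
          ← f_d_apply, eq_sub_of_add_eq' hz''.symm, hz₁]
        simp only [map_sub, map_add, map_neg]
        abel)
    refine ⟨p₁, q', hp₁, pullback_ext ?_ ?_⟩
    -- Writing `x'` as `(x' + s p) - s p` brings in `hx''`; the term `-s p` is the one that `φ p₁`
    -- contributes because `d p₁ = p`.
    · rw [map_add, f_d_apply, hq₁, hfst hjk hkl, hp₁, map_sub, map_add, map_add, d_d_apply,
        ← f_d_apply, ← hx', ← add_sub_cancel_right x' (s j k hjk p), hx'', hx₁, map_add]
      abel
    · rw [map_add, f_d_apply, hq₂, hsnd, map_add, ← f_d_apply, ← hy', hy'', hy₁, map_add]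
      abel
  have hiso : IsIso (toHo.map φ) :=
    (HomologicalComplex.quasiIso (ModuleCat.{u} ℝ) (ComplexShape.down ℤ)).Q_inverts φ hφ
  refine ⟨asIso (toHo.map φ), ?_, ?_⟩
  · rw [asIso_hom, ← Functor.map_comp, pullback.lift_fst, toHo_map_homotopyBoundary_sub]
  · rw [asIso_hom, ← Functor.map_comp, pullback.lift_snd]

end HomotopyPullback

/-! ### The graph of a map against the zero section -/

section HomotopyFibre

variable {F G P : Ch.{u}}

/-- If a chain homotopy `h` between `p ≫ v` and `0` identifies `Pₙ` with `Fₙ × Gₙ₊₁`, then `P` is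
the homotopy pullback of the graph of `v` and the zero section of `F × G`. -/
theorem isHomotopyPullback_graph_zero (v : F ⟶ G) (p : P ⟶ F)
    (h : ∀ i j : ℤ, i + 1 = j → (P.X i ⟶ G.X j)) (hv : p ≫ v = homotopyBoundary h)
    (hinj : ∀ (i j : ℤ) (hij : i + 1 = j) (x y : P.X i), p.f i x = p.f i y →
      h i j hij x = h i j hij y → x = y)
    (hsurj : ∀ (i j : ℤ) (hij : i + 1 = j) (x : F.X i) (w : G.X j),
      ∃ y : P.X i, p.f i y = x ∧ h i j hij y = w) :
    IsHomotopyPullback (prod.lift (𝟙 F) v) (prod.lift (𝟙 F) 0) p p := by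
  let π₁ : F ⨯ G ⟶ F := prod.fst
  let π₂ : F ⨯ G ⟶ G := prod.snd
  let κ : G ⟶ F ⨯ G := prod.lift 0 (𝟙 G)
  have hκ₁ : ∀ n x, π₁.f n (κ.f n x) = 0 := fun n x => by
    rw [← comp_f_apply, prod.lift_fst]
    rfl
  have hκ₂ : ∀ n x, π₂.f n (κ.f n x) = x := fun n x => by
    rw [← comp_f_apply, prod.lift_snd]
    rfl
  have hfst : ∀ (w : F ⟶ G) n x, π₁.f n ((prod.lift (𝟙 F) w).f n x) = x := fun w n x => by
    rw [← comp_f_apply, prod.lift_fst]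
    rfl
  have hsnd : ∀ (w : F ⟶ G) n x, π₂.f n ((prod.lift (𝟙 F) w).f n x) = w.f n x := fun w n x => by
    rw [← comp_f_apply, prod.lift_snd]
  have hext : ∀ n (y y' : (F ⨯ G).X n), π₁.f n y = π₁.f n y' → π₂.f n y = π₂.f n y' → y = y' := by
    intro n y y' h₁ h₂
    -- The zero section and `κ` are the two inclusions of the summands, so every element is
    -- recovered from its components.
    have e : π₁ ≫ prod.lift (𝟙 F) 0 + π₂ ≫ κ = 𝟙 (F ⨯ G) := by
      refine prod.hom_ext ?_ ?_
      · rw [Preadditive.add_comp, Category.assoc, Category.assoc, prod.lift_fst, prod.lift_fst,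
          comp_zero, add_zero, Category.comp_id, Category.id_comp]
      · rw [Preadditive.add_comp, Category.assoc, Category.assoc, prod.lift_snd, prod.lift_snd,
          comp_zero, zero_add, Category.comp_id, Category.id_comp]
    have e' : ∀ y, y = (prod.lift (𝟙 F) (0 : F ⟶ G)).f n (π₁.f n y) + κ.f n (π₂.f n y) :=
      fun y => (congrArg (fun φ : F ⨯ G ⟶ F ⨯ G => φ.f n y) e).symm
    rw [e' y, e' y', h₁, h₂]
  refine isHomotopyPullback_of_homotopy _ _ _ _ (fun i j hij => h i j hij ≫ κ.f j) ?_ ?_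
  · rw [← homotopyBoundary_comp, ← hv]
    refine prod.hom_ext ?_ ?_
    · rw [Preadditive.sub_comp, Category.assoc, Category.assoc, Category.assoc, prod.lift_fst,
        prod.lift_fst, prod.lift_fst, comp_zero, sub_self]
    · rw [Preadditive.sub_comp, Category.assoc, Category.assoc, Category.assoc, prod.lift_snd,
        prod.lift_snd, prod.lift_snd, comp_zero, sub_zero, Category.comp_id]
  · intro i j k l n hij hjk hkl hln q x y z hq hx hy hz
    have hz₁ : - x + y = F.d l k (π₁.f l z) := by
      have := congrArg (π₁.f k) hz
      rw [map_add, map_sub, hfst, hfst, f_d_apply, ModuleCat.comp_apply, hκ₁, zero_sub] at this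
      exact this
    have hz₂ : h j k hjk q - v.f k x = G.d l k (π₂.f l z) := by
      have := congrArg (π₂.f k) hz
      rw [map_add, map_sub, hsnd, hsnd, f_d_apply, ModuleCat.comp_apply, hκ₂] at this
      exact (add_zero _).symm.trans this
    -- The field `x` and the fibre component of `z` prescribe `q'`, with a minus sign because `z`
    -- has to equal `-h q'` in the fibre. The base component of `z` is the chain whose boundary is
    -- `y - x`, hence serves as `y'`, and the remaining two witnesses are zero.
    obtain ⟨q', hq₁, hq₂⟩ := hsurj k l hkl x (-π₂.f l z)
    refine ⟨q', 0, π₁.f l z, 0, hinj j k hjk _ _ ?_ ?_, ?_, ?_, hext _ _ _ ?_ ?_⟩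
    · rw [f_d_apply, hq₁, hx]
    -- The homotopy identity gives `h (d q') = v x - d (h q')`, which is `h q` by `hz₂`; injectivity
    -- then yields `d q' = q`.
    · have := homotopyBoundary_f_apply h hjk hkl q'
      rw [← hv, comp_f_apply, hq₁, hq₂, map_neg, ← hz₂] at this
      rw [eq_sub_of_add_eq this.symm]
      abel
    · rw [map_zero, add_zero, hq₁]
    · rw [hq₁, ← hz₁]
      abel
    · simp only [map_zero, add_zero, sub_zero, map_add, map_neg, ModuleCat.comp_apply, hκ₁, hfst,
        neg_zero, zero_add]
    · simp only [map_zero, add_zero, sub_zero, map_add, map_neg, ModuleCat.comp_apply, hκ₂, hsnd,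
        hq₂, neg_neg]
      exact (add_zero _).symm

end HomotopyFibre

/-! ### The solution complex as a homotopy fibre -/

section Solutions

variable {m : ℕ} {M : Type u} [TopologicalSpace M] [ChartedSpace (Model m) M]
  [IsManifold (𝓡 m) ∞ M] (hm : 2 ≤ m) (S : Spacetime m M)

theorem zeroMod_hom_ext {A : ModuleCat.{u} ℝ} (f g : A ⟶ zeroMod) : f = g :=
  ModuleCat.hom_ext (LinearMap.ext fun _ => Subsingleton.elim (α := PUnit) _ _)

/-- The components of `solHomotopy`. -/
noncomputable def solHomotopyF : ∀ n : ℤ, (Sol hm S).X n ⟶ (dualFields hm S).X (n + 1)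
  | .negSucc 0 => 𝟙 (Om m M 1)
  | .negSucc 1 => 𝟙 (Om m M 0)
  | .ofNat _ => 0
  | .negSucc (_ + 2) => 0

/-- The chain homotopy between `𝔖𝔬𝔩 ⟶ 𝔉 ⟶ 𝔉*` and `0`, which is the identity on the antifields. -/
noncomputable def solHomotopy (i j : ℤ) (hij : i + 1 = j) :
    (Sol hm S).X i ⟶ (dualFields hm S).X j :=
  solHomotopyF hm S i ≫ eqToHom (by rw [hij])

theorem solHomotopy_succ (i : ℤ) : solHomotopy hm S i (i + 1) rfl = solHomotopyF hm S i :=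
  Category.comp_id _

/-- In degree 0 the identity expresses that the differential of `Sol` from fields to antifields is
the variation `δd`. In degree -1 it is the cancellation `δ + (-δ) = 0`, for which 𝔉* needs its sign.
Elsewhere both sides vanish. -/
theorem solToFields_variation :
    solToFields hm S ≫ variation hm S = homotopyBoundary (solHomotopy hm S) := by
  ext n : 1
  -- With the degree written as a successor, both homotopy components have targets of the form `i +
  -- 1`, and no transport along an equality of degrees remains.
  obtain ⟨n, rfl⟩ : ∃ k, n = k + 1 := ⟨n - 1, by ring⟩
  rw [homotopyBoundary_f (solHomotopy hm S) rfl rfl, solHomotopy_succ, solHomotopy_succ]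
  have e₁ : (Sol hm S).d (n + 1) n = fourTermD (d₀ m M) (δd hm S) (δ₁ hm S) n :=
    fourTerm_d _ _ _ _ _ n
  have e₂ : (dualFields hm S).d (n + 1 + 1) (n + 1) =
    fourTermD (0 : zeroMod ⟶ Om m M 1) (-δ₁ hm S) (0 : Om m M 0 ⟶ zeroMod) (n + 1) :=
    fourTerm_d _ _ _ _ _ (n + 1)
  rw [e₁, e₂]
  match n with
  | .ofNat 0 =>
    change 𝟙 (Om m M 0) ≫ (0 : Om m M 0 ⟶ zeroMod) =
      d₀ m M ≫ (0 : Om m M 1 ⟶ zeroMod) + (0 : Om m M 0 ⟶ zeroMod) ≫ (0 : zeroMod ⟶ zeroMod)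
    simp
  | .ofNat (k + 1) =>
    exact zeroMod_hom_ext _ _
  | .negSucc 0 =>
    change 𝟙 (Om m M 1) ≫ δd hm S = δd hm S ≫ 𝟙 (Om m M 1) +
      (0 : Om m M 1 ⟶ zeroMod) ≫ (0 : zeroMod ⟶ Om m M 1)
    simp
  | .negSucc 1 =>
    change (0 : Om m M 1 ⟶ zeroMod) ≫ (0 : zeroMod ⟶ Om m M 0) = δ₁ hm S ≫ 𝟙 (Om m M 0) +
      𝟙 (Om m M 1) ≫ (-δ₁ hm S)
    simp
  | .negSucc 2 =>
    change (0 : Om m M 0 ⟶ zeroMod) ≫ (0 : zeroMod ⟶ zeroMod) =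
      (0 : Om m M 0 ⟶ zeroMod) ≫ (0 : zeroMod ⟶ zeroMod) +
      𝟙 (Om m M 0) ≫ (0 : Om m M 0 ⟶ zeroMod)
    simp
  | .negSucc (k + 3) =>
    exact zeroMod_hom_ext _ _

/-- In the degrees 0 and 1 an element is its own field component, in the degrees -1 and -2 it is its
own value under the homotopy, and the other groups are zero. -/
theorem solHomotopy_injective (i j : ℤ) (hij : i + 1 = j) (x y : (Sol hm S).X i)
    (h₁ : (solToFields hm S).f i x = (solToFields hm S).f i y)
    (h₂ : solHomotopy hm S i j hij x = solHomotopy hm S i j hij y) : x = y := by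
  subst hij
  rw [solHomotopy_succ] at h₂
  match i with
  | .ofNat 0 => exact h₁
  | .ofNat 1 => exact h₁
  | .ofNat (k + 2) => exact Subsingleton.elim (α := PUnit) x y
  | .negSucc 0 => exact h₂
  | .negSucc 1 => exact h₂
  | .negSucc (k + 2) => exact Subsingleton.elim (α := PUnit) x y

theorem solHomotopy_surjective (i j : ℤ) (hij : i + 1 = j) (x : (fields m M).X i)
    (w : (dualFields hm S).X j) :
    ∃ y : (Sol hm S).X i, (solToFields hm S).f i y = x ∧ solHomotopy hm S i j hij y = w := by
  subst hij
  rw [solHomotopy_succ]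
  match i with
  | .ofNat 0 => exact ⟨x, rfl, Subsingleton.elim (α := PUnit) _ _⟩
  | .ofNat 1 => exact ⟨x, rfl, Subsingleton.elim (α := PUnit) _ _⟩
  | .ofNat (k + 2) =>
    exact ⟨PUnit.unit, Subsingleton.elim (α := PUnit) _ _, Subsingleton.elim (α := PUnit) _ _⟩
  | .negSucc 0 => exact ⟨w, Subsingleton.elim (α := PUnit) _ _, rfl⟩
  | .negSucc 1 => exact ⟨w, Subsingleton.elim (α := PUnit) _ _, rfl⟩
  -- Degree -3 is separate because its partner, degree -2 of 𝔉*, is the last named slot of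
  -- `fourTermX`; further down the default value takes over. Both are the zero space.
  | .negSucc 2 =>
    exact ⟨PUnit.unit, Subsingleton.elim (α := PUnit) _ _, Subsingleton.elim (α := PUnit) _ _⟩
  | .negSucc (k + 3) =>
    exact ⟨PUnit.unit, Subsingleton.elim (α := PUnit) _ _, Subsingleton.elim (α := PUnit) _ _⟩

end Solutions

end YangMills

theorem proposition3p10 {m : ℕ} (hm : 2 ≤ m) (M : Type u) [TopologicalSpace M] [T2Space M]
    [SecondCountableTopology M] [ChartedSpace (EuclideanSpace ℝ (Fin m)) M]
    [IsManifold (𝓡 m) ∞ M] (S : YangMills.Spacetime m M) :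
    YangMills.IsHomotopyPullback (YangMills.dS hm S) (YangMills.zeroSection hm S)
      (YangMills.solToFields hm S) (YangMills.solToFields hm S) :=
  YangMills.isHomotopyPullback_graph_zero (YangMills.variation hm S) (YangMills.solToFields hm S)
    (YangMills.solHomotopy hm S) (YangMills.solToFields_variation hm S)
    (YangMills.solHomotopy_injective hm S) (YangMills.solHomotopy_surjective hm S)
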